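/- **Setting.** For a subset $E$ of the standard basis (the axes) $U$ of $\mathbb R^M$ let $\mathcal O(E)=\{\sum_{u\in E}\lambda_u u : \lambda_u>0\}$ be the open orthant with axes $E$. An orthant space $X$ of dimension $m$ is a union of such orthants in $\mathbb R^M$, of maximal dimension $m$, such that (a) with each orthant it contains all the orthants in its closure, and (b) it contains every orthant of dimension at least $2$ all of whose $2$-dimensional faces it contains. It carries its intrinsic metric: $d(x,y)$ is the infimum of the Euclidean lengths of the piecewise linear paths in $X$ from $x$ to $y$. Any two points are joined by a unique geodesic. The carrier of a (non-constant) geodesic is the sequence, in order of traversal, of the orthants that it meets in a piece of positive length. For $x,y\in X$ let $E(x)$ be the set of axes along which $x$ has a positive coordinate, and let $$E(x,y)=(E(x)\cap E(y))\cup\{e\in E(x):\mathcal O(\{e\}\cup E(y))\subseteq X\}\cup\{e\in E(y):\mathcal O(\{e\}\cup E(x))\subseteq X\}.$$ Let $P_E(x)$ be the orthogonal projection of $x$ onto the span of $E$. **Proposition.** Let $X$ be an orthant space, $x_1,x_2\in X$ and $k>0$. Let $\mathcal A=(A_0,\dots,A_k)$ and $\mathcal B=(B_0,\dots,B_k)$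 be sequences of sets of axes with $A_0=B_0=E(x_1,x_2)$ (possibly empty), such that $A_1,\dots,A_k,B_1,\dots,B_k$ are non-empty, the sets $A_0,A_1,\dots,A_k,B_1,\dots,B_k$ are mutually disjoint, and the orthants $$\mathcal O_i=\mathcal O(A_0\cup B_1\cup\dots\cup B_i\cup A_{i+1}\cup\dots\cup A_k),\qquad 0\le i\le k,$$ are all contained in $X$. Then $(\mathcal A,\mathcal B)$ is the support of the geodesic from $x_1$ to $x_2$, i.e. $(\mathcal O_0,\dots,\mathcal O_k)$ is the carrier of that geodesic, if and only if $A_1\cup\dots\cup A_k=E(x_1)\setminus A_0$ and $B_1\cup\dots\cup B_k=E(x_2)\setminus B_0$ and the following two conditions hold: (i) for all $0<i<k$, $$\frac{\|P_{A_i}(x_1)\|}{\|P_{B_i}(x_2)\|}<\frac{\|P_{A_{i+1}}(x_1)\|}{\|P_{B_{i+1}}(x_2)\|};$$ (ii) for all $0<i\le k$ and all disjoint decompositions $A_i=C_1\cup C_2$ and $B_i=D_1\cup D_2$ with $C_1\cup D_1\neq\emptyset$ and $C_2\cup D_2\ne\emptyset$ (a single one of the four parts, or one of $C_1,D_1$ together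 with one of $C_2,D_2$, may be empty), if the orthant $$\mathcal O(B_0\cup\dots\cup B_{i-1}\cup D_1\cup C_2\cup A_{i+1}\cup\dots\cup A_k)$$ is contained in $X$, then $$\frac{\|P_{C_1}(x_1)\|}{\|P_{D_1}(x_2)\|}\ \ge\ \frac{\|P_{C_2}(x_1)\|}{\|P_{D_2}(x_2)\|}.$$ Here the norm of the projection onto the empty set of axes is $0$, ratios are taken in $[0,\infty]$, and $a/0=\infty$ for $a>0$. -/

import Mathlib

open scoped ENNReal

namespace Orthant

noncomputable section

/-- Euclidean space `ℝ^M`; the axes `u_1, …, u_M` are represented by the elements of `Fin M`. -/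
abbrev Euc (M : ℕ) : Type := EuclideanSpace ℝ (Fin M)

/-- The open positive orthant `O(E)`. -/
def orthant {M : ℕ} (E : Finset (Fin M)) : Set (Euc M) :=
  {x | (∀ e ∈ E, 0 < x e) ∧ ∀ e, e ∉ E → x e = 0}

/-- `X ⊆ ℝ^M` is an orthant space of dimension `m`.  The flag condition is only required for
orthants of dimension at least two: one-dimensional orthants of `ℝ^M` need not belong to `X`. -/
structure IsOrthantSpace {M : ℕ} (m : ℕ) (X : Set (Euc M)) : Prop where
  union_orthants : ∀ x ∈ X, ∃ E : Finset (Fin M), x ∈ orthant E ∧ orthant E ⊆ X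
  dim_attained : ∃ E : Finset (Fin M), orthant E ⊆ X ∧ E.card = m
  dim_le : ∀ E : Finset (Fin M), orthant E ⊆ X → E.card ≤ m
  closure_mem : ∀ E F : Finset (Fin M), orthant E ⊆ X →
    orthant F ⊆ closure (orthant E) → orthant F ⊆ X
  flag : ∀ E : Finset (Fin M), 2 ≤ E.card →
    (∀ F : Finset (Fin M), F.card = 2 → orthant F ⊆ closure (orthant E) → orthant F ⊆ X) →
    orthant E ⊆ X

/-- The lengths of the piecewise linear paths in `X` from `x` to `y`; such a path is given by its
successive vertices `p 0, …, p n`. -/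
def pathLengths {M : ℕ} (X : Set (Euc M)) (x y : Euc M) : Set ℝ :=
  {L | ∃ (n : ℕ) (p : ℕ → Euc M), p 0 = x ∧ p n = y ∧ x ∈ X ∧
    (∀ i < n, segment ℝ (p i) (p (i + 1)) ⊆ X) ∧
    L = ∑ i ∈ Finset.range n, dist (p i) (p (i + 1))}

/-- The intrinsic metric of `X`.  In an orthant space any two points are joined by a piecewise
linear path (through the origin), so the infimum is over a non-empty set. -/
def intrinsicDist {M : ℕ} (X : Set (Euc M)) (x y : Euc M) : ℝ :=
  sInf (pathLengths X x y)

/-- `γ`, restricted to `[0,1]`, is a geodesic from `x` to `y` in `X` for the intrinsic metric,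
parametrised proportionally to arc length. -/
def IsGeodesic {M : ℕ} (X : Set (Euc M)) (x y : Euc M) (γ : ℝ → Euc M) : Prop :=
  γ 0 = x ∧ γ 1 = y ∧ (∀ s ∈ Set.Icc (0 : ℝ) 1, γ s ∈ X) ∧
    ∀ s ∈ Set.Icc (0 : ℝ) 1, ∀ t ∈ Set.Icc (0 : ℝ) 1,
      intrinsicDist X (γ s) (γ t) = |s - t| * intrinsicDist X x y

/-- The carrier of the geodesic `γ : [0,1] → X` is the sequence of distinct strata
`O(F 0), …, O(F k)`: apart from finitely many points, `γ` passes successively through these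
orthants, along a piece of positive length in each of them. -/
def HasCarrier {M : ℕ} (γ : ℝ → Euc M) (k : ℕ) (F : ℕ → Finset (Fin M)) : Prop :=
  γ 0 ≠ γ 1 ∧ Set.InjOn F (Set.Iic k) ∧
    ∃ t : ℕ → ℝ, t 0 = 0 ∧ t (k + 1) = 1 ∧
      ∀ i ≤ k, t i < t (i + 1) ∧ ∀ s ∈ Set.Ioo (t i) (t (i + 1)), γ s ∈ orthant (F i)

/-- The axes `A_0 ∪ B_1 ∪ ⋯ ∪ B_i ∪ A_{i+1} ∪ ⋯ ∪ A_k` of the orthant `O_i`. -/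
def stage {M : ℕ} (k : ℕ) (A B : ℕ → Finset (Fin M)) (i : ℕ) : Finset (Fin M) :=
  A 0 ∪ (Finset.Icc 1 i).biUnion B ∪ (Finset.Icc (i + 1) k).biUnion A

/-- `((A_0, …, A_k), (B_0, …, B_k))` is the support of the geodesic from `x` to `y` in `X`:
the carrier of that geodesic is `(O_0, …, O_k)`.  (Geodesics in an orthant space are unique.)
Only the values of `A` and `B` at indices `≤ k` matter. -/
def IsSupport {M : ℕ} (X : Set (Euc M)) (x y : Euc M) (k : ℕ) (A B : ℕ → Finset (Fin M)) : Prop :=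
  ∃ γ : ℝ → Euc M, IsGeodesic X x y γ ∧ HasCarrier γ k (stage k A B)

/-- `E` and `F` are compatible in `X`. -/
def Compatible {M : ℕ} (X : Set (Euc M)) (E F : Finset (Fin M)) : Prop :=
  orthant (E ∪ F) ⊆ X

open Classical in
/-- `E(x)`: the axes along which `x` has a positive coordinate. -/
def posAxes {M : ℕ} (x : Euc M) : Finset (Fin M) :=
  Finset.univ.filter fun e => 0 < x e

open Classical in
/-- `E(x, y)`. -/
def commonAxes {M : ℕ} (X : Set (Euc M)) (x y : Euc M) : Finset (Fin M) :=
  (posAxes x ∩ posAxes y) ∪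
    (posAxes x).filter (fun e => Compatible X {e} (posAxes y)) ∪
    (posAxes y).filter (fun e => Compatible X {e} (posAxes x))

/-- `P_E(x)`: the orthogonal projection of `x` onto the coordinate subspace spanned by `E`. -/
def proj {M : ℕ} (E : Finset (Fin M)) (x : Euc M) : Euc M :=
  WithLp.toLp 2 fun e => if e ∈ E then x e else 0

/-- The ratio `‖P_E(x)‖ / ‖P_F(y)‖` in `[0, ∞]`, where `a / 0 = ∞` for `a > 0`. -/
def ratio {M : ℕ} (x y : Euc M) (E F : Finset (Fin M)) : ℝ≥0∞ :=
  ‖proj E x‖ₑ / ‖proj F y‖ₑ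

/-- The axes `B_0 ∪ ⋯ ∪ B_{i-1} ∪ D₁ ∪ C₂ ∪ A_{i+1} ∪ ⋯ ∪ A_k` of the orthant `O'`. -/
def refinedStage {M : ℕ} (k : ℕ) (A B : ℕ → Finset (Fin M)) (i : ℕ) (D₁ C₂ : Finset (Fin M)) :
    Finset (Fin M) :=
  (Finset.range i).biUnion B ∪ D₁ ∪ C₂ ∪ (Finset.Icc (i + 1) k).biUnion A

end

end Orthant

/-! Write `a_j = ‖P_{A_j}(x₁)‖` and `b_j = ‖P_{B_j}(x₂)‖`. In the candidate geodesic the coordinates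
in `A_j` shrink linearly to zero at the time `t_j = a_j / (a_j + b_j)`, and those in `B_j` grow
linearly from that time on. This choice gives both blocks the same velocity norm `a_j + b_j`, so
exchanging one for the other preserves the speed. The squared length is `‖P_{A_0}(x₂ - x₁)‖² + ∑
(a_j + b_j)²`. Condition (i) says exactly that the times increase.

Sufficiency is a calibration argument. Each coordinate has a single velocity while it moves. These
velocities form a vector `v` with `⟨v, x₂ - x₁⟩ = l²`, where `l` is the length of the candidate
(`IsLadder.sum_velocity_mul`). If `v` has norm at most `l` on every orthant of `X`, the functional
`⟨v, ·⟩` is `l`-Lipschitz for the intrinsic metric (`IsOrthantSpace.sum_mul_sub_le`), so no path is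
shorter than `l`. The bound on an orthant `E` splits into blocks. For block `j` put `C₂ = A_j ∩ E`
and `D₁ = B_j ∩ E`. By the flag condition the corresponding refined orthant lies in `X`, and the
inequality of (ii) is equivalent to the bound wanted (`sq_div_sq_add_sq_div_sq_le`).

For necessity, a geodesic with the given carrier is affine on each leg and its common coordinates
are not refracted at a crossing (`eq_of_two_mul_le_intrinsicDist`). Constant speed then makes the
velocities of `A_j` and `B_j` equal in norm. Hence `a_j / b_j = t_j / (1 - t_j)`, which gives (i).
If (ii) failed for some decomposition, a short piece of the geodesic around `t_j` could be replaced
by a path exchanging `C₁` for `D₁` first and `C₂` for `D₂` later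
(`intrinsicDist_sq_le_of_two_steps`), which is strictly shorter. -/

namespace Orthant

/-! ### Closed orthants and faces -/

/-- The closed orthant with axes `E`. -/
def closedOrthant {M : ℕ} (E : Finset (Fin M)) : Set (Euc M) :=
  {x | (∀ e, 0 ≤ x e) ∧ ∀ e, e ∉ E → x e = 0}

variable {M m : ℕ} {X : Set (Euc M)}

lemma mem_posAxes {x : Euc M} {e : Fin M} : e ∈ posAxes x ↔ 0 < x e := by
  simp [posAxes]

lemma orthant_subset_closedOrthant (E : Finset (Fin M)) : orthant E ⊆ closedOrthant E := by
  intro x hx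
  refine ⟨fun e => ?_, hx.2⟩
  by_cases he : e ∈ E
  · exact (hx.1 e he).le
  · exact (hx.2 e he).ge

lemma mem_orthant_posAxes {x : Euc M} (hx : ∀ e, 0 ≤ x e) : x ∈ orthant (posAxes x) :=
  ⟨fun _ he => mem_posAxes.1 he, fun e he => le_antisymm (not_lt.1 (mt mem_posAxes.2 he)) (hx e)⟩

lemma convex_closedOrthant (E : Finset (Fin M)) : Convex ℝ (closedOrthant E) := by
  intro x hx y hy a b ha hb _
  refine ⟨fun e => ?_, fun e he => ?_⟩
  · have h1 := hx.1 e
    have h2 := hy.1 e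
    simp only [PiLp.add_apply, PiLp.smul_apply, smul_eq_mul]
    positivity
  · simp [hx.2 e he, hy.2 e he]

lemma isClosed_closedOrthant (E : Finset (Fin M)) : IsClosed (closedOrthant E) := by
  have : closedOrthant E = (⋂ e, {x : Euc M | 0 ≤ x e}) ∩ ⋂ e, ⋂ (_ : e ∉ E), {x | x e = 0} := by
    ext x
    simp [closedOrthant]
  rw [this]
  refine IsClosed.inter (isClosed_iInter fun e => ?_)
    (isClosed_iInter fun e => isClosed_iInter fun _ => ?_)
  · exact isClosed_le continuous_const (by fun_prop)
  · exact isClosed_eq (by fun_prop) continuous_const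

lemma orthant_subset_closure {E F : Finset (Fin M)} (h : F ⊆ E) :
    orthant F ⊆ closure (orthant E) := by
  classical
  intro x hx
  let w : Euc M := WithLp.toLp 2 fun e => if e ∈ E then 1 else 0
  have hlim : Filter.Tendsto (fun n : ℕ => x + (1 / ((n : ℝ) + 1)) • w) Filter.atTop
      (nhds (x + (0 : ℝ) • w)) :=
    tendsto_const_nhds.add (tendsto_one_div_add_atTop_nhds_zero_nat.smul_const w)
  rw [zero_smul, add_zero] at hlim
  refine mem_closure_of_tendsto hlim (Filter.Eventually.of_forall fun n => ⟨fun e he => ?_, ?_⟩)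
  · have h0 := (orthant_subset_closedOrthant F hx).1 e
    have h1 : (0 : ℝ) < 1 / ((n : ℝ) + 1) := by positivity
    simp only [PiLp.add_apply, PiLp.smul_apply, smul_eq_mul, w, he, if_true, mul_one]
    linarith
  · intro e he
    simp [w, he, hx.2 e fun h' => he (h h')]

lemma subset_of_orthant_subset_closure {E F : Finset (Fin M)}
    (h : orthant F ⊆ closure (orthant E)) : F ⊆ E := by
  classical
  intro e he
  let w : Euc M := WithLp.toLp 2 fun e => if e ∈ F then 1 else 0
  have hw : w ∈ orthant F := ⟨fun e he => by simp [w, he], fun e he => by simp [w, he]⟩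
  have h2 := closure_minimal (orthant_subset_closedOrthant E) (isClosed_closedOrthant E) (h hw)
  by_contra hE
  have := h2.2 e hE
  simp [w, he] at this

namespace IsOrthantSpace

lemma orthant_subset_of_subset (hX : IsOrthantSpace m X) {E F : Finset (Fin M)}
    (hE : orthant E ⊆ X) (h : F ⊆ E) : orthant F ⊆ X :=
  hX.closure_mem E F hE (orthant_subset_closure h)

lemma closedOrthant_subset (hX : IsOrthantSpace m X) {E : Finset (Fin M)} (hE : orthant E ⊆ X) :
    closedOrthant E ⊆ X := by
  intro x hx
  refine hX.orthant_subset_of_subset hE (fun e he => ?_) (mem_orthant_posAxes hx.1)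
  by_contra h
  exact (mem_posAxes.1 he).ne' (hx.2 e h)

lemma nonneg (hX : IsOrthantSpace m X) {x : Euc M} (hx : x ∈ X) (e : Fin M) : 0 ≤ x e := by
  obtain ⟨E, hE, -⟩ := hX.union_orthants x hx
  exact (orthant_subset_closedOrthant E hE).1 e

lemma orthant_posAxes_subset (hX : IsOrthantSpace m X) {x : Euc M} (hx : x ∈ X) :
    orthant (posAxes x) ⊆ X := by
  obtain ⟨E, hE, hEX⟩ := hX.union_orthants x hx
  refine hX.orthant_subset_of_subset hEX fun e he => ?_
  by_contra h
  exact (mem_posAxes.1 he).ne' (hE.2 e h)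

/-- A segment in an orthant space lies in one of its closed orthants. -/
lemma exists_of_segment_subset (hX : IsOrthantSpace m X) {p q : Euc M}
    (h : segment ℝ p q ⊆ X) :
    ∃ E : Finset (Fin M), orthant E ⊆ X ∧ ∀ e, e ∉ E → p e = 0 ∧ q e = 0 := by
  -- Coordinates in `X` are nonnegative, so the midpoint is positive on every axis where an endpoint
  -- is.
  have hm : midpoint ℝ p q ∈ X := h (midpoint_mem_segment p q)
  refine ⟨_, hX.orthant_posAxes_subset hm, fun e he => ?_⟩
  have h1 := hX.nonneg (h (left_mem_segment ℝ p q)) e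
  have h2 := hX.nonneg (h (right_mem_segment ℝ p q)) e
  have h3 : ¬ 0 < midpoint ℝ p q e := mt mem_posAxes.2 he
  simp only [midpoint_eq_smul_add, PiLp.smul_apply, PiLp.add_apply, smul_eq_mul, invOf_eq_inv,
    not_lt] at h3
  constructor <;> linarith

lemma pathLengths_nonempty (hX : IsOrthantSpace m X) {x y : Euc M} (hx : x ∈ X) (hy : y ∈ X) :
    (pathLengths X x y).Nonempty := by
  have key : ∀ z ∈ X, segment ℝ z 0 ⊆ X := fun z hz =>
    ((convex_closedOrthant _).segment_subset
      (orthant_subset_closedOrthant _ (mem_orthant_posAxes (hX.nonneg hz)))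
      ⟨fun _ => le_rfl, fun _ _ => rfl⟩).trans
      (hX.closedOrthant_subset (hX.orthant_posAxes_subset hz))
  refine ⟨_, 2, fun i => if i = 0 then x else if i = 1 then 0 else y, by simp, by simp, hx, ?_, rfl⟩
  intro i hi
  interval_cases i
  · simpa using key x hx
  · simpa [segment_symm] using key y hy

end IsOrthantSpace

/-! ### The intrinsic metric and its Lipschitz functionals -/

lemma bddBelow_pathLengths (x y : Euc M) : BddBelow (pathLengths X x y) := by
  refine ⟨0, ?_⟩
  rintro L ⟨n, p, -, -, -, -, rfl⟩
  exact Finset.sum_nonneg fun _ _ => dist_nonneg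

lemma pathLengths_add {x y z : Euc M} {a b : ℝ} (ha : a ∈ pathLengths X x y)
    (hb : b ∈ pathLengths X y z) : a + b ∈ pathLengths X x z := by
  obtain ⟨n, p, hp0, hpn, hx, hp, rfl⟩ := ha
  obtain ⟨l, q, hq0, hql, -, hq, rfl⟩ := hb
  have h1 : ∀ i ≤ n, (if i ≤ n then p i else q (i - n)) = p i := fun i hi => if_pos hi
  -- At `i = 0` the test selects `p n`, which agrees with `q 0` because both are the point where the
  -- paths join.
  have h2 : ∀ i, (if n + i ≤ n then p (n + i) else q (n + i - n)) = q i := by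
    intro i
    rcases Nat.eq_zero_or_pos i with rfl | hi
    · simp [hpn, hq0]
    · rw [if_neg (by omega), Nat.add_sub_cancel_left]
  refine ⟨n + l, fun i => if i ≤ n then p i else q (i - n), ?_, ?_, hx, ?_, ?_⟩
  · simp [hp0]
  · exact (h2 l).trans hql
  · intro i hi
    rcases lt_or_ge i n with h | h
    · beta_reduce
      rw [h1 i h.le, h1 (i + 1) h]
      exact hp i h
    · obtain ⟨j, rfl⟩ := Nat.exists_eq_add_of_le h
      beta_reduce
      rw [add_assoc, h2, h2]
      exact hq j (by omega)
  · rw [Finset.sum_range_add]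
    congr 1
    · refine Finset.sum_congr rfl fun i hi => ?_
      rw [Finset.mem_range] at hi
      beta_reduce
      rw [h1 i hi.le, h1 (i + 1) hi]
    · refine Finset.sum_congr rfl fun i _ => ?_
      beta_reduce
      rw [add_assoc, h2, h2]

lemma pathLengths_symm {x y : Euc M} {a : ℝ} (hy : y ∈ X) (ha : a ∈ pathLengths X x y) :
    a ∈ pathLengths X y x := by
  obtain ⟨n, p, hp0, hpn, hx, hp, rfl⟩ := ha
  refine ⟨n, fun i => p (n - i), by simpa, by simpa, hy, fun i hi => ?_, ?_⟩
  · have h := hp (n - (i + 1)) (by omega)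
    rw [show n - (i + 1) + 1 = n - i by omega] at h
    rwa [segment_symm]
  · rw [← Finset.sum_range_reflect]
    refine Finset.sum_congr rfl fun i hi => ?_
    rw [Finset.mem_range] at hi
    rw [dist_comm, show n - 1 - i + 1 = n - i by omega, show n - 1 - i = n - (i + 1) by omega]

lemma intrinsicDist_le_dist {x y : Euc M} (h : segment ℝ x y ⊆ X) :
    intrinsicDist X x y ≤ dist x y := by
  refine csInf_le (bddBelow_pathLengths x y)
    ⟨1, fun i => if i = 0 then x else y, by simp, by simp, h (left_mem_segment ℝ x y), ?_, by simp⟩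
  intro i hi
  interval_cases i
  simpa using h

namespace IsOrthantSpace

lemma intrinsicDist_triangle (hX : IsOrthantSpace m X) {x y z : Euc M} (hx : x ∈ X) (hy : y ∈ X)
    (hz : z ∈ X) : intrinsicDist X x z ≤ intrinsicDist X x y + intrinsicDist X y z := by
  refine le_of_forall_pos_le_add fun ε hε => ?_
  obtain ⟨a, ha, ha'⟩ := exists_lt_of_csInf_lt (hX.pathLengths_nonempty hx hy)
    (lt_add_of_pos_right (intrinsicDist X x y) (half_pos hε))
  obtain ⟨b, hb, hb'⟩ := exists_lt_of_csInf_lt (hX.pathLengths_nonempty hy hz)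
    (lt_add_of_pos_right (intrinsicDist X y z) (half_pos hε))
  have := csInf_le (bddBelow_pathLengths x z) (pathLengths_add ha hb)
  change intrinsicDist X x z ≤ _ at this
  linarith

lemma intrinsicDist_comm (_hX : IsOrthantSpace m X) {x y : Euc M} (hx : x ∈ X) (hy : y ∈ X) :
    intrinsicDist X x y = intrinsicDist X y x :=
  congrArg sInf (Set.ext fun _ => ⟨pathLengths_symm hy, pathLengths_symm hx⟩)

lemma dist_le_intrinsicDist (hX : IsOrthantSpace m X) {x y : Euc M} (hx : x ∈ X) (hy : y ∈ X) :
    dist x y ≤ intrinsicDist X x y := by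
  refine le_csInf (hX.pathLengths_nonempty hx hy) ?_
  rintro L ⟨n, p, rfl, rfl, -, -, rfl⟩
  exact dist_le_range_sum_dist p n

lemma intrinsicDist_eq_dist (hX : IsOrthantSpace m X) {E : Finset (Fin M)} (hE : orthant E ⊆ X)
    {x y : Euc M} (hx : x ∈ closedOrthant E) (hy : y ∈ closedOrthant E) :
    intrinsicDist X x y = dist x y :=
  le_antisymm (intrinsicDist_le_dist
      (((convex_closedOrthant E).segment_subset hx hy).trans (hX.closedOrthant_subset hE)))
    (hX.dist_le_intrinsicDist (hX.closedOrthant_subset hE hx) (hX.closedOrthant_subset hE hy))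

/-- A linear functional whose restriction to each orthant of `X` has norm at most `K` is
`K`-Lipschitz for the intrinsic metric. -/
lemma sum_mul_sub_le (hX : IsOrthantSpace m X) (v : Euc M) {K : ℝ} (hK : 0 < K)
    (h : ∀ E : Finset (Fin M), orthant E ⊆ X → ∑ e ∈ E, v e ^ 2 ≤ K ^ 2)
    {x y : Euc M} (hx : x ∈ X) (hy : y ∈ X) :
    ∑ e, v e * (y e - x e) ≤ K * intrinsicDist X x y := by
  rw [mul_comm, ← div_le_iff₀ hK]
  refine le_csInf (hX.pathLengths_nonempty hx hy) ?_
  rintro L ⟨n, p, rfl, rfl, -, hp, rfl⟩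
  rw [div_le_iff₀ hK, mul_comm, Finset.mul_sum]
  have htel : ∑ e, v e * (p n e - p 0 e)
      = ∑ i ∈ Finset.range n, ∑ e, v e * (p (i + 1) e - p i e) := by
    rw [Finset.sum_comm]
    refine Finset.sum_congr rfl fun e _ => ?_
    rw [← Finset.mul_sum, Finset.sum_range_sub (fun i => p i e)]
  rw [htel]
  refine Finset.sum_le_sum fun i hi => ?_
  -- A straight piece changes only coordinates in one orthant of `X`, so Cauchy–Schwarz needs the
  -- norm of `v` on that orthant alone.
  obtain ⟨E, hE, hpE⟩ := hX.exists_of_segment_subset (hp i (Finset.mem_range.1 hi))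
  have h1 : ∑ e, v e * (p (i + 1) e - p i e) = ∑ e ∈ E, v e * (p (i + 1) e - p i e) := by
    refine (Finset.sum_subset (Finset.subset_univ E) fun e _ he => ?_).symm
    rw [(hpE e he).1, (hpE e he).2]
    ring
  have h2 : ∑ e ∈ E, (p (i + 1) e - p i e) ^ 2 ≤ dist (p i) (p (i + 1)) ^ 2 := by
    rw [dist_comm, dist_eq_norm, EuclideanSpace.real_norm_sq_eq]
    exact Finset.sum_le_sum_of_subset_of_nonneg (Finset.subset_univ E) fun _ _ _ => sq_nonneg _
  rw [h1]
  refine (le_abs_self _).trans (abs_le_of_sq_le_sq ?_ (by positivity))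
  calc (∑ e ∈ E, v e * (p (i + 1) e - p i e)) ^ 2
      ≤ (∑ e ∈ E, v e ^ 2) * ∑ e ∈ E, (p (i + 1) e - p i e) ^ 2 :=
        Finset.sum_mul_sq_le_sq_mul_sq _ _ _
    _ ≤ K ^ 2 * dist (p i) (p (i + 1)) ^ 2 :=
        mul_le_mul (h E hE) h2 (Finset.sum_nonneg fun _ _ => sq_nonneg _) (sq_nonneg K)
    _ = _ := by ring

end IsOrthantSpace

/-! ### Norms of projections and comparison of ratios -/

lemma norm_proj_sq (E : Finset (Fin M)) (x : Euc M) : ‖proj E x‖ ^ 2 = ∑ e ∈ E, x e ^ 2 := by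
  rw [EuclideanSpace.real_norm_sq_eq, ← Finset.sum_subset (Finset.subset_univ E)]
  · exact Finset.sum_congr rfl fun e he => by simp [proj, he]
  · exact fun e _ he => by simp [proj, he]

lemma norm_proj_pos {E : Finset (Fin M)} {x : Euc M} (h : ∀ e ∈ E, x e ≠ 0) (hE : E.Nonempty) :
    0 < ‖proj E x‖ := by
  have h1 : 0 < ‖proj E x‖ ^ 2 := by
    rw [norm_proj_sq]
    exact Finset.sum_pos (fun e he => by have := h e he; positivity) hE
  exact lt_of_le_of_ne (norm_nonneg _) fun h0 => by simp [← h0] at h1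

lemma norm_proj_congr_mul {E : Finset (Fin M)} {x y : Euc M} {c : ℝ}
    (h : ∀ e ∈ E, x e = c * y e) : ‖proj E x‖ = |c| * ‖proj E y‖ := by
  have h1 : proj E x = c • proj E y := by
    ext e
    by_cases he : e ∈ E
    · simp [proj, he, h e he]
    · simp [proj, he]
  rw [h1, norm_smul, Real.norm_eq_abs]

lemma norm_proj_union_sq {C D : Finset (Fin M)} (h : Disjoint C D) (x : Euc M) :
    ‖proj (C ∪ D) x‖ ^ 2 = ‖proj C x‖ ^ 2 + ‖proj D x‖ ^ 2 := by
  simp only [norm_proj_sq, Finset.sum_union h]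

/-- The conditions `hab` and `hcd` exclude `0 / 0`, which would be `0` in `ℝ≥0∞`.
Cross-multiplication is then valid even with a zero denominator. -/
lemma ofReal_div_lt_ofReal_div_iff {a b c d : ℝ} (ha : 0 ≤ a) (hb : 0 ≤ b)
    (hd : 0 ≤ d) (hab : 0 < a ∨ 0 < b) (hcd : 0 < c ∨ 0 < d) :
    ENNReal.ofReal a / ENNReal.ofReal b < ENNReal.ofReal c / ENNReal.ofReal d ↔
      a * d < c * b := by
  rcases hb.eq_or_lt with rfl | hb'
  · have ha' : 0 < a := hab.resolve_right (lt_irrefl _)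
    rw [ENNReal.ofReal_zero, ENNReal.div_zero (by simpa using ha')]
    simpa using mul_nonneg ha hd
  · rcases hd.eq_or_lt with rfl | hd'
    · have hc' : 0 < c := hcd.resolve_right (lt_irrefl _)
      rw [ENNReal.ofReal_zero, ENNReal.div_zero (by simpa using hc'),
        ← ENNReal.ofReal_div_of_pos hb']
      simpa using mul_pos hc' hb'
    · rw [← ENNReal.ofReal_div_of_pos hb', ← ENNReal.ofReal_div_of_pos hd',
        ENNReal.ofReal_lt_ofReal_iff_of_nonneg (by positivity), div_lt_div_iff₀ hb' hd']

lemma ratio_lt_ratio_iff {x y : Euc M} {C₁ C₂ D₁ D₂ : Finset (Fin M)}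
    (hC₁ : ∀ e ∈ C₁, x e ≠ 0) (hC₂ : ∀ e ∈ C₂, x e ≠ 0)
    (hD₁ : ∀ e ∈ D₁, y e ≠ 0) (hD₂ : ∀ e ∈ D₂, y e ≠ 0)
    (h₁ : (C₁ ∪ D₁).Nonempty) (h₂ : (C₂ ∪ D₂).Nonempty) :
    ratio x y C₁ D₁ < ratio x y C₂ D₂ ↔
      ‖proj C₁ x‖ * ‖proj D₂ y‖ < ‖proj C₂ x‖ * ‖proj D₁ y‖ := by
  simp only [ratio, ← ofReal_norm]
  refine ofReal_div_lt_ofReal_div_iff (norm_nonneg _) (norm_nonneg _) (norm_nonneg _) ?_ ?_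
  · exact (Finset.union_nonempty.1 h₁).imp (norm_proj_pos hC₁) (norm_proj_pos hD₁)
  · exact (Finset.union_nonempty.1 h₂).imp (norm_proj_pos hC₂) (norm_proj_pos hD₂)

/-! ### Combinatorics of the stages -/

lemma mem_stage {k : ℕ} {A B : ℕ → Finset (Fin M)} {i : ℕ} {e : Fin M} :
    e ∈ stage k A B i ↔
      e ∈ A 0 ∨ (∃ j, 1 ≤ j ∧ j ≤ i ∧ e ∈ B j) ∨ ∃ j, i + 1 ≤ j ∧ j ≤ k ∧ e ∈ A j := by
  simp only [stage, Finset.mem_union, Finset.mem_biUnion, Finset.mem_Icc, or_assoc, and_assoc]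

/-- The sets `A 0, …, A k, B 1, …, B k` are mutually disjoint. -/
structure DisjointAxes (k : ℕ) (A B : ℕ → Finset (Fin M)) : Prop where
  disjAA : ∀ i ≤ k, ∀ j ≤ k, i ≠ j → Disjoint (A i) (A j)
  disjBB : ∀ i j, 1 ≤ i → i ≤ k → 1 ≤ j → j ≤ k → i ≠ j → Disjoint (B i) (B j)
  disjAB : ∀ i ≤ k, ∀ j, 1 ≤ j → j ≤ k → Disjoint (A i) (B j)

namespace DisjointAxes

variable {k : ℕ} {A B : ℕ → Finset (Fin M)}

lemma notMem_zero (h : DisjointAxes k A B) {j : ℕ} (hj : 1 ≤ j) (hjk : j ≤ k) {e : Fin M}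
    (he : e ∈ A j ∪ B j) : e ∉ A 0 := by
  intro h0
  rcases Finset.mem_union.1 he with he | he
  · exact Finset.disjoint_left.1 (h.disjAA 0 (Nat.zero_le k) j hjk (by omega)) h0 he
  · exact Finset.disjoint_left.1 (h.disjAB 0 (Nat.zero_le k) j hj hjk) h0 he

lemma unique_index (h : DisjointAxes k A B) {i j : ℕ} (hi : 1 ≤ i) (hik : i ≤ k) (hj : 1 ≤ j)
    (hjk : j ≤ k) {e : Fin M} (hei : e ∈ A i ∪ B i) (hej : e ∈ A j ∪ B j) : i = j := by
  by_contra hne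
  rcases Finset.mem_union.1 hei with hei | hei <;> rcases Finset.mem_union.1 hej with hej | hej
  · exact Finset.disjoint_left.1 (h.disjAA i hik j hjk hne) hei hej
  · exact Finset.disjoint_left.1 (h.disjAB i hik j hj hjk) hei hej
  · exact Finset.disjoint_left.1 (h.disjAB j hjk i hi hik) hej hei
  · exact Finset.disjoint_left.1 (h.disjBB i j hi hik hj hjk hne) hei hej

lemma mem_stage_A (h : DisjointAxes k A B) {i j : ℕ} (hi : i ≤ k) (hj : 1 ≤ j) (hjk : j ≤ k)
    {e : Fin M} (he : e ∈ A j) : e ∈ stage k A B i ↔ i < j := by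
  refine ⟨fun hs => ?_, fun hij => mem_stage.2 (Or.inr (Or.inr ⟨j, hij, hjk, he⟩))⟩
  have heu := Finset.mem_union_left (B j) he
  rcases mem_stage.1 hs with h0 | ⟨l, hl, hli, hel⟩ | ⟨l, hl, hlk, hel⟩
  · exact absurd h0 (h.notMem_zero hj hjk heu)
  · exact absurd hel (Finset.disjoint_left.1 (h.disjAB j hjk l hl (by omega)) he)
  · have := h.unique_index (by omega) hlk hj hjk (Finset.mem_union_left (B l) hel) heu
    omega

lemma mem_stage_B (h : DisjointAxes k A B) {i j : ℕ} (hi : i ≤ k) (hj : 1 ≤ j) (hjk : j ≤ k)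
    {e : Fin M} (he : e ∈ B j) : e ∈ stage k A B i ↔ j ≤ i := by
  refine ⟨fun hs => ?_, fun hij => mem_stage.2 (Or.inr (Or.inl ⟨j, hj, hij, he⟩))⟩
  have heu := Finset.mem_union_right (A j) he
  rcases mem_stage.1 hs with h0 | ⟨l, hl, hli, hel⟩ | ⟨l, hl, hlk, hel⟩
  · exact absurd h0 (h.notMem_zero hj hjk heu)
  · have := h.unique_index hl (by omega) hj hjk (Finset.mem_union_right (A l) hel) heu
    omega
  · exact absurd he (Finset.disjoint_left.1 (h.disjAB l hlk j hj hjk) hel)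

lemma stage_injOn (h : DisjointAxes k A B)
    (hne : ∀ i, 1 ≤ i → i ≤ k → (A i).Nonempty) : Set.InjOn (stage k A B) (Set.Iic k) := by
  have key : ∀ i j, i < j → j ≤ k → stage k A B i ≠ stage k A B j := by
    intro i j hij hj heq
    obtain ⟨e, he⟩ := hne j (by omega) hj
    have h1 := h.mem_stage_A (hij.le.trans hj) (by omega) hj he
    have h2 := h.mem_stage_A hj (by omega) hj he
    rw [heq] at h1
    exact absurd (h2.1 (h1.2 hij)) (by omega)
  intro i hi j hj hij
  rcases lt_trichotomy i j with hlt | heq | hlt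
  · exact absurd hij (key i j hlt hj)
  · exact heq
  · exact absurd hij.symm (key j i hlt hi)

end DisjointAxes

/-! ### Ladder paths: construction and length -/

/-- The data of a path from `p` to `q` through the orthants `stage k A B i`, on which the
coordinates in `A j` vanish, and those in `B j` start to grow, at the time `t j`. -/
structure IsLadder (k : ℕ) (A B : ℕ → Finset (Fin M)) (t : ℕ → ℝ) (p q : Euc M) : Prop
    extends DisjointAxes k A B where
  t_zero : t 0 = 0
  t_last : t (k + 1) = 1
  -- Legs of zero duration are allowed: the two-step shortcut may have `t 1 = 0` or `t 2 = 1`.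
  t_le_succ : ∀ i ≤ k, t i ≤ t (i + 1)
  p_nonneg : ∀ e, 0 ≤ p e
  q_nonneg : ∀ e, 0 ≤ q e
  p_zero : ∀ e, e ∉ stage k A B 0 → p e = 0
  q_zero : ∀ e, e ∉ stage k A B k → q e = 0
  -- This is `t j = a_j / (a_j + b_j)` without the division, so that empty blocks are covered.
  balance : ∀ j, 1 ≤ j → j ≤ k → ‖proj (A j) p‖ = t j * (‖proj (A j) p‖ + ‖proj (B j) q‖)

/-- The time at which the coordinate `e` vanishes or starts to grow. -/
noncomputable def crossTime (k : ℕ) (A B : ℕ → Finset (Fin M)) (t : ℕ → ℝ) (e : Fin M) : ℝ :=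
  ∑ j ∈ Finset.Icc 1 k, if e ∈ A j ∪ B j then t j else 0

/-- The path defined by a ladder. -/
noncomputable def ladderPath (k : ℕ) (A B : ℕ → Finset (Fin M)) (t : ℕ → ℝ) (p q : Euc M)
    (s : ℝ) : Euc M :=
  WithLp.toLp 2 fun e => if e ∈ A 0 then (1 - s) * p e + s * q e else
    p e * max 0 (1 - s / crossTime k A B t e) +
      q e * max 0 ((s - crossTime k A B t e) / (1 - crossTime k A B t e))

/-- The velocities of the coordinates of the path defined by a ladder. -/
noncomputable def ladderVelocity (k : ℕ) (A B : ℕ → Finset (Fin M)) (t : ℕ → ℝ) (p q : Euc M) :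
    Euc M :=
  WithLp.toLp 2 fun e => if e ∈ A 0 then q e - p e else
    q e / (1 - crossTime k A B t e) - p e / crossTime k A B t e

/-- The square of the length of the path defined by a ladder. -/
noncomputable def ladderSq (k : ℕ) (A B : ℕ → Finset (Fin M)) (p q : Euc M) : ℝ :=
  ‖proj (A 0) (q - p)‖ ^ 2 +
    ∑ j ∈ Finset.Icc 1 k, (‖proj (A j) p‖ + ‖proj (B j) q‖) ^ 2

lemma ladderSq_nonneg (k : ℕ) (A B : ℕ → Finset (Fin M)) (p q : Euc M) :
    0 ≤ ladderSq k A B p q :=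
  add_nonneg (sq_nonneg _) (Finset.sum_nonneg fun _ _ => sq_nonneg _)

/-- A path that has speed at most `l` on each of finitely many consecutive legs has speed at
most `l`. -/
lemma intrinsicDist_le_of_legs (hX : IsOrthantSpace m X) {γ : ℝ → Euc M} {l : ℝ} {t : ℕ → ℝ}
    {k : ℕ} (ht : ∀ i ≤ k, t i ≤ t (i + 1))
    (hγ : ∀ i ≤ k, ∀ s ∈ Set.Icc (t i) (t (i + 1)), γ s ∈ X)
    (h : ∀ i ≤ k, ∀ s ∈ Set.Icc (t i) (t (i + 1)), ∀ s' ∈ Set.Icc (t i) (t (i + 1)), s ≤ s' →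
      intrinsicDist X (γ s) (γ s') ≤ (s' - s) * l) :
    ∀ n ≤ k, ∀ s s', t 0 ≤ s → s ≤ s' → s' ≤ t (n + 1) →
      (γ s ∈ X ∧ γ s' ∈ X) ∧ intrinsicDist X (γ s) (γ s') ≤ (s' - s) * l := by
  intro n
  induction n with
  | zero =>
    intro _ s s' h0 h1 h2
    exact ⟨⟨hγ 0 (Nat.zero_le k) s ⟨h0, h1.trans h2⟩, hγ 0 (Nat.zero_le k) s' ⟨h0.trans h1, h2⟩⟩,
      h 0 (Nat.zero_le k) s ⟨h0, h1.trans h2⟩ s' ⟨h0.trans h1, h2⟩ h1⟩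
  | succ n ih =>
    intro hn s s' h0 h1 h2
    rcases le_total s' (t (n + 1)) with h3 | h3
    · exact ih (by omega) s s' h0 h1 h3
    rcases le_total (t (n + 1)) s with h4 | h4
    · exact ⟨⟨hγ _ hn s ⟨h4, h1.trans h2⟩, hγ _ hn s' ⟨h3, h2⟩⟩,
        h _ hn s ⟨h4, h1.trans h2⟩ s' ⟨h3, h2⟩ h1⟩
    · obtain ⟨⟨ha, hb⟩, hab⟩ := ih (by omega) s (t (n + 1)) h0 h4 le_rfl
      have hc := hγ _ hn s' ⟨h3, h2⟩
      have hbc := h _ hn (t (n + 1)) ⟨le_rfl, ht _ hn⟩ s' ⟨h3, h2⟩ h3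
      refine ⟨⟨ha, hc⟩, (hX.intrinsicDist_triangle ha hb hc).trans ?_⟩
      linarith

lemma le_of_le_succ {t : ℕ → ℝ} {k : ℕ} (ht : ∀ i ≤ k, t i ≤ t (i + 1)) {i j : ℕ} (hij : i ≤ j)
    (hj : j ≤ k + 1) : t i ≤ t j := by
  induction j, hij using Nat.le_induction with
  | base => exact le_rfl
  | succ n _ ih => exact (ih (by omega)).trans (ht n (by omega))

namespace IsLadder

variable {k : ℕ} {A B : ℕ → Finset (Fin M)} {t : ℕ → ℝ} {p q : Euc M}

lemma t_mono (h : IsLadder k A B t p q) {i j : ℕ} (hij : i ≤ j) (hj : j ≤ k + 1) : t i ≤ t j :=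
  le_of_le_succ h.t_le_succ hij hj

lemma t_nonneg (h : IsLadder k A B t p q) {j : ℕ} (hj : j ≤ k + 1) : 0 ≤ t j :=
  h.t_zero ▸ h.t_mono (Nat.zero_le j) hj

lemma t_le_one (h : IsLadder k A B t p q) {j : ℕ} (hj : j ≤ k + 1) : t j ≤ 1 :=
  h.t_last ▸ h.t_mono hj le_rfl

lemma crossTime_eq (h : IsLadder k A B t p q) {j : ℕ} (hj : 1 ≤ j) (hjk : j ≤ k) {e : Fin M}
    (he : e ∈ A j ∪ B j) : crossTime k A B t e = t j := by
  rw [crossTime, Finset.sum_eq_single_of_mem j (Finset.mem_Icc.2 ⟨hj, hjk⟩), if_pos he]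
  intro i hi hij
  rw [Finset.mem_Icc] at hi
  exact if_neg fun hei => hij (h.unique_index hi.1 hi.2 hj hjk hei he)

lemma q_eq_zero (h : IsLadder k A B t p q) {j : ℕ} (hj : 1 ≤ j) (hjk : j ≤ k) {e : Fin M}
    (he : e ∈ A j) : q e = 0 :=
  h.q_zero e fun hs => absurd ((h.mem_stage_A le_rfl hj hjk he).1 hs) (by omega)

lemma p_eq_zero (h : IsLadder k A B t p q) {j : ℕ} (hj : 1 ≤ j) (hjk : j ≤ k) {e : Fin M}
    (he : e ∈ B j) : p e = 0 :=
  h.p_zero e fun hs => absurd ((h.mem_stage_B (Nat.zero_le k) hj hjk he).1 hs) (by omega)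

lemma p_eq_zero_of_t_eq_zero (h : IsLadder k A B t p q) {j : ℕ} (hj : 1 ≤ j) (hjk : j ≤ k)
    {e : Fin M} (he : e ∈ A j) (ht : t j = 0) : p e = 0 := by
  have h1 := h.balance j hj hjk
  rw [ht, zero_mul, norm_eq_zero] at h1
  have h2 : proj (A j) p e = p e := by simp [proj, he]
  rw [← h2, h1, PiLp.zero_apply]

lemma balance' (h : IsLadder k A B t p q) {j : ℕ} (hj : 1 ≤ j) (hjk : j ≤ k) :
    ‖proj (B j) q‖ = (1 - t j) * (‖proj (A j) p‖ + ‖proj (B j) q‖) := by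
  linarith [h.balance j hj hjk]

lemma q_eq_zero_of_t_eq_one (h : IsLadder k A B t p q) {j : ℕ} (hj : 1 ≤ j) (hjk : j ≤ k)
    {e : Fin M} (he : e ∈ B j) (ht : t j = 1) : q e = 0 := by
  have h1 := h.balance' hj hjk
  rw [ht, sub_self, zero_mul, norm_eq_zero] at h1
  have h2 : proj (B j) q e = q e := by simp [proj, he]
  rw [← h2, h1, PiLp.zero_apply]

lemma path_zero (_h : IsLadder k A B t p q) {e : Fin M} (he : e ∈ A 0) (s : ℝ) :
    ladderPath k A B t p q s e = (1 - s) * p e + s * q e := by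
  simp [ladderPath, he]

lemma path_A (h : IsLadder k A B t p q) {j : ℕ} (hj : 1 ≤ j) (hjk : j ≤ k) {e : Fin M}
    (he : e ∈ A j) {s : ℝ} (hs : s ≤ t j) :
    ladderPath k A B t p q s e = p e * (1 - s / t j) := by
  have heu := Finset.mem_union_left (B j) he
  simp only [ladderPath, h.notMem_zero hj hjk heu, if_false, h.q_eq_zero hj hjk he, zero_mul,
    add_zero, h.crossTime_eq hj hjk heu]
  rw [max_eq_right (sub_nonneg.2 (div_le_one_of_le₀ hs (h.t_nonneg (by omega))))]

lemma path_A_eq_zero (h : IsLadder k A B t p q) {j : ℕ} (hj : 1 ≤ j) (hjk : j ≤ k) {e : Fin M}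
    (he : e ∈ A j) {s : ℝ} (hs : t j ≤ s) : ladderPath k A B t p q s e = 0 := by
  have heu := Finset.mem_union_left (B j) he
  simp only [ladderPath, h.notMem_zero hj hjk heu, if_false, h.q_eq_zero hj hjk he, zero_mul,
    add_zero, h.crossTime_eq hj hjk heu]
  -- If `t j = 0` the factor `1 - s / 0` equals `1` by convention; the product vanishes because
  -- `balance` forces `p e = 0`.
  rcases (h.t_nonneg (show j ≤ k + 1 by omega)).eq_or_lt with h0 | h0
  · rw [h.p_eq_zero_of_t_eq_zero hj hjk he h0.symm, zero_mul]
  · rw [max_eq_left (sub_nonpos.2 ((one_le_div h0).2 hs)), mul_zero]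

lemma path_B (h : IsLadder k A B t p q) {j : ℕ} (hj : 1 ≤ j) (hjk : j ≤ k) {e : Fin M}
    (he : e ∈ B j) {s : ℝ} (hs : t j ≤ s) :
    ladderPath k A B t p q s e = q e * ((s - t j) / (1 - t j)) := by
  have heu := Finset.mem_union_right (A j) he
  simp only [ladderPath, h.notMem_zero hj hjk heu, if_false, h.p_eq_zero hj hjk he, zero_mul,
    zero_add, h.crossTime_eq hj hjk heu]
  rw [max_eq_right (div_nonneg (sub_nonneg.2 hs) (sub_nonneg.2 (h.t_le_one (by omega))))]

lemma path_B_eq_zero (h : IsLadder k A B t p q) {j : ℕ} (hj : 1 ≤ j) (hjk : j ≤ k) {e : Fin M}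
    (he : e ∈ B j) {s : ℝ} (hs : s ≤ t j) : ladderPath k A B t p q s e = 0 := by
  have heu := Finset.mem_union_right (A j) he
  simp only [ladderPath, h.notMem_zero hj hjk heu, if_false, h.p_eq_zero hj hjk he, zero_mul,
    zero_add, h.crossTime_eq hj hjk heu]
  rw [max_eq_left (div_nonpos_of_nonpos_of_nonneg (sub_nonpos.2 hs)
    (sub_nonneg.2 (h.t_le_one (by omega)))), mul_zero]

/-- Every axis is in `A 0`, or in one of the other `A j`, or in one of the other `B j`, or is
irrelevant. -/
lemma cases_axis (h : IsLadder k A B t p q) (e : Fin M) :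
    e ∈ A 0 ∨ (∃ j, 1 ≤ j ∧ j ≤ k ∧ e ∈ A j) ∨ (∃ j, 1 ≤ j ∧ j ≤ k ∧ e ∈ B j) ∨
      (e ∉ A 0 ∧ (∀ i, e ∈ stage k A B i → k < i) ∧ p e = 0 ∧ q e = 0) := by
  by_cases h0 : e ∈ A 0
  · exact Or.inl h0
  by_cases hA : ∃ j, 1 ≤ j ∧ j ≤ k ∧ e ∈ A j
  · exact Or.inr (Or.inl hA)
  by_cases hB : ∃ j, 1 ≤ j ∧ j ≤ k ∧ e ∈ B j
  · exact Or.inr (Or.inr (Or.inl hB))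
  have key : ∀ i, e ∈ stage k A B i → k < i := by
    intro i hi
    by_contra! hik
    rcases mem_stage.1 hi with h1 | ⟨j, hj, hji, hej⟩ | ⟨j, hj, hjk, hej⟩
    · exact h0 h1
    · exact hB ⟨j, hj, hji.trans hik, hej⟩
    · exact hA ⟨j, by omega, hjk, hej⟩
  exact Or.inr (Or.inr (Or.inr ⟨h0, key, h.p_zero e fun hs => absurd (key 0 hs) (by omega),
    h.q_zero e fun hs => absurd (key k hs) (by omega)⟩))

lemma path_eq_zero (_h : IsLadder k A B t p q) {e : Fin M} (he : e ∉ A 0) (hp : p e = 0)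
    (hq : q e = 0) (s : ℝ) : ladderPath k A B t p q s e = 0 := by
  simp [ladderPath, he, hp, hq]

lemma path_start (h : IsLadder k A B t p q) : ladderPath k A B t p q 0 = p := by
  ext e
  rcases h.cases_axis e with he | ⟨j, hj, hjk, he⟩ | ⟨j, hj, hjk, he⟩ | ⟨h0, -, hp, hq⟩
  · simp [h.path_zero he]
  · simp [h.path_A hj hjk he (h.t_nonneg (by omega))]
  · rw [h.path_B_eq_zero hj hjk he (h.t_nonneg (by omega)), h.p_eq_zero hj hjk he]
  · rw [h.path_eq_zero h0 hp hq, hp]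

lemma path_end (h : IsLadder k A B t p q) : ladderPath k A B t p q 1 = q := by
  ext e
  rcases h.cases_axis e with he | ⟨j, hj, hjk, he⟩ | ⟨j, hj, hjk, he⟩ | ⟨h0, -, hp, hq⟩
  · simp [h.path_zero he]
  · rw [h.path_A_eq_zero hj hjk he (h.t_le_one (by omega)), h.q_eq_zero hj hjk he]
  · rw [h.path_B hj hjk he (h.t_le_one (by omega))]
    by_cases h1 : t j = 1
    · simp [h.q_eq_zero_of_t_eq_one hj hjk he h1]
    · rw [div_self (sub_ne_zero.2 (Ne.symm h1)), mul_one]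
  · rw [h.path_eq_zero h0 hp hq, hq]

lemma path_mem_closedOrthant (h : IsLadder k A B t p q) {i : ℕ} (hi : i ≤ k) {s : ℝ}
    (hs : s ∈ Set.Icc (t i) (t (i + 1))) :
    ladderPath k A B t p q s ∈ closedOrthant (stage k A B i) := by
  have hs0 : 0 ≤ s := (h.t_nonneg (by omega)).trans hs.1
  have hs1 : s ≤ 1 := hs.2.trans (h.t_le_one (by omega))
  have hp := h.p_nonneg
  have hq := h.q_nonneg
  refine ⟨fun e => ?_, fun e hes => ?_⟩
  · have h1 : 0 ≤ 1 - s := by linarith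
    have := hp e
    have := hq e
    simp only [ladderPath]
    split_ifs <;> positivity
  · rcases h.cases_axis e with he | ⟨j, hj, hjk, he⟩ | ⟨j, hj, hjk, he⟩ | ⟨h0, -, hp, hq⟩
    · exact absurd (mem_stage.2 (Or.inl he)) hes
    · rw [h.mem_stage_A hi hj hjk he, not_lt] at hes
      exact h.path_A_eq_zero hj hjk he ((h.t_mono hes (by omega)).trans hs.1)
    · rw [h.mem_stage_B hi hj hjk he, not_le] at hes
      exact h.path_B_eq_zero hj hjk he (hs.2.trans (h.t_mono hes (by omega)))
    · exact h.path_eq_zero h0 hp hq s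

lemma velocity_zero (_h : IsLadder k A B t p q) {e : Fin M} (he : e ∈ A 0) :
    ladderVelocity k A B t p q e = q e - p e := by
  simp [ladderVelocity, he]

lemma velocity_A (h : IsLadder k A B t p q) {j : ℕ} (hj : 1 ≤ j) (hjk : j ≤ k) {e : Fin M}
    (he : e ∈ A j) : ladderVelocity k A B t p q e = -(p e / t j) := by
  have heu := Finset.mem_union_left (B j) he
  simp [ladderVelocity, h.notMem_zero hj hjk heu, h.q_eq_zero hj hjk he, h.crossTime_eq hj hjk heu]

lemma velocity_B (h : IsLadder k A B t p q) {j : ℕ} (hj : 1 ≤ j) (hjk : j ≤ k) {e : Fin M}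
    (he : e ∈ B j) : ladderVelocity k A B t p q e = q e / (1 - t j) := by
  have heu := Finset.mem_union_right (A j) he
  simp [ladderVelocity, h.notMem_zero hj hjk heu, h.p_eq_zero hj hjk he, h.crossTime_eq hj hjk heu]

lemma path_sub (h : IsLadder k A B t p q) {i : ℕ} (hi : i ≤ k) {s s' : ℝ}
    (hs : s ∈ Set.Icc (t i) (t (i + 1))) (hs' : s' ∈ Set.Icc (t i) (t (i + 1))) {e : Fin M}
    (he : e ∈ stage k A B i) :
    ladderPath k A B t p q s' e - ladderPath k A B t p q s e =
      (s' - s) * ladderVelocity k A B t p q e := by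
  rcases h.cases_axis e with h0 | ⟨j, hj, hjk, hej⟩ | ⟨j, hj, hjk, hej⟩ | ⟨-, h0, -, -⟩
  · rw [h.path_zero h0, h.path_zero h0, h.velocity_zero h0]
    ring
  · rw [h.mem_stage_A hi hj hjk hej] at he
    have ht : t (i + 1) ≤ t j := h.t_mono he (by omega)
    rw [h.path_A hj hjk hej (hs.2.trans ht), h.path_A hj hjk hej (hs'.2.trans ht),
      h.velocity_A hj hjk hej]
    ring
  · rw [h.mem_stage_B hi hj hjk hej] at he
    have ht : t j ≤ t i := h.t_mono he (by omega)
    rw [h.path_B hj hjk hej (ht.trans hs.1), h.path_B hj hjk hej (ht.trans hs'.1),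
      h.velocity_B hj hjk hej]
    ring
  · exact absurd (h0 i he) (by omega)

lemma sum_stage (h : IsLadder k A B t p q) {i : ℕ} (hi : i ≤ k) (g : Fin M → ℝ) :
    ∑ e ∈ stage k A B i, g e = ∑ e ∈ A 0, g e + (∑ j ∈ Finset.Icc 1 i, ∑ e ∈ B j, g e +
      ∑ j ∈ Finset.Icc (i + 1) k, ∑ e ∈ A j, g e) := by
  rw [stage, Finset.sum_union, Finset.sum_union, Finset.sum_biUnion, Finset.sum_biUnion, add_assoc]
  · intro a ha b hb hab
    simp only [Finset.coe_Icc, Set.mem_Icc] at ha hb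
    exact h.disjAA a ha.2 b hb.2 hab
  · intro a ha b hb hab
    simp only [Finset.coe_Icc, Set.mem_Icc] at ha hb
    exact h.disjBB a b ha.1 (ha.2.trans hi) hb.1 (hb.2.trans hi) hab
  · refine (Finset.disjoint_biUnion_right _ _ _).2 fun j hj => ?_
    rw [Finset.mem_Icc] at hj
    exact h.disjAB 0 (Nat.zero_le k) j hj.1 (hj.2.trans hi)
  · refine (Finset.disjoint_biUnion_right _ _ _).2 fun j hj => Finset.disjoint_union_left.2 ⟨?_, ?_⟩
    · rw [Finset.mem_Icc] at hj
      exact h.disjAA 0 (Nat.zero_le k) j hj.2 (by omega)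
    · refine (Finset.disjoint_biUnion_left _ _ _).2 fun l hl => ?_
      rw [Finset.mem_Icc] at hj hl
      exact (h.disjAB j hj.2 l hl.1 (hl.2.trans hi)).symm

lemma sum_velocity_sq_A (h : IsLadder k A B t p q) {j : ℕ} (hj : 1 ≤ j) (hjk : j ≤ k)
    {C : Finset (Fin M)} (hC : C ⊆ A j) :
    ∑ e ∈ C, ladderVelocity k A B t p q e ^ 2 = ‖proj C p‖ ^ 2 / t j ^ 2 := by
  rw [norm_proj_sq, Finset.sum_div]
  refine Finset.sum_congr rfl fun e he => ?_
  rw [h.velocity_A hj hjk (hC he), neg_sq, div_pow]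

lemma sum_velocity_sq_B (h : IsLadder k A B t p q) {j : ℕ} (hj : 1 ≤ j) (hjk : j ≤ k)
    {D : Finset (Fin M)} (hD : D ⊆ B j) :
    ∑ e ∈ D, ladderVelocity k A B t p q e ^ 2 = ‖proj D q‖ ^ 2 / (1 - t j) ^ 2 := by
  rw [norm_proj_sq, Finset.sum_div]
  refine Finset.sum_congr rfl fun e he => ?_
  rw [h.velocity_B hj hjk (hD he), div_pow]

/-- By `balance`, `a_j / t_j = a_j + b_j = b_j / (1 - t_j)` whenever the divisors are nonzero, so
all legs have the same speed. A leg of positive duration guarantees `t j < 1` for the `B j` present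
and `0 < t j` for the `A j` present. -/
lemma sum_velocity_sq_stage (h : IsLadder k A B t p q) {i : ℕ} (hi : i ≤ k)
    (ht : t i < t (i + 1)) :
    ∑ e ∈ stage k A B i, ladderVelocity k A B t p q e ^ 2 = ladderSq k A B p q := by
  have hIcc : Finset.Icc 1 k = Finset.Icc 1 i ∪ Finset.Icc (i + 1) k := by
    ext j
    simp only [Finset.mem_Icc, Finset.mem_union]
    omega
  have hdisj : Disjoint (Finset.Icc 1 i) (Finset.Icc (i + 1) k) := by
    rw [Finset.disjoint_left]
    intro j
    simp only [Finset.mem_Icc]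
    omega
  rw [h.sum_stage hi, ladderSq, hIcc, Finset.sum_union hdisj, norm_proj_sq]
  congr 1
  · exact Finset.sum_congr rfl fun e he => by rw [h.velocity_zero he, PiLp.sub_apply]
  congr 1
  · refine Finset.sum_congr rfl fun j hj => ?_
    rw [Finset.mem_Icc] at hj
    have h1 : t j < 1 := ((h.t_mono hj.2 (by omega)).trans_lt ht).trans_le (h.t_le_one (by omega))
    have h2 : (1 - t j) ^ 2 ≠ 0 := pow_ne_zero 2 (by linarith)
    rw [h.sum_velocity_sq_B hj.1 (by omega) subset_rfl, div_eq_iff h2, ← mul_pow, mul_comm,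
      ← h.balance' hj.1 (by omega)]
  · refine Finset.sum_congr rfl fun j hj => ?_
    rw [Finset.mem_Icc] at hj
    have h1 : 0 < t j := ((h.t_nonneg (by omega)).trans_lt ht).trans_le (h.t_mono hj.1 (by omega))
    rw [h.sum_velocity_sq_A (by omega) hj.2 subset_rfl, div_eq_iff (pow_ne_zero 2 h1.ne'),
      ← mul_pow, mul_comm, ← h.balance j (by omega) hj.2]

lemma dist_path (h : IsLadder k A B t p q) {i : ℕ} (hi : i ≤ k) {s s' : ℝ}
    (hs : s ∈ Set.Icc (t i) (t (i + 1))) (hs' : s' ∈ Set.Icc (t i) (t (i + 1))) (hss' : s ≤ s') :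
    dist (ladderPath k A B t p q s) (ladderPath k A B t p q s') =
      (s' - s) * √(ladderSq k A B p q) := by
  rcases hss'.eq_or_lt with rfl | hlt
  · simp
  have ht : t i < t (i + 1) := (hs.1.trans_lt hlt).trans_le hs'.2
  rw [← Real.sqrt_sq (sub_nonneg.2 hss'), ← Real.sqrt_mul (sq_nonneg _), dist_comm, dist_eq_norm,
    EuclideanSpace.norm_eq, ← h.sum_velocity_sq_stage hi ht, Finset.mul_sum]
  congr 1
  rw [← Finset.sum_subset (Finset.subset_univ (stage k A B i))]
  · refine Finset.sum_congr rfl fun e he => ?_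
    rw [Real.norm_eq_abs, sq_abs, PiLp.sub_apply, h.path_sub hi hs hs' he, mul_pow]
  · intro e _ he
    rw [PiLp.sub_apply, (h.path_mem_closedOrthant hi hs).2 e he,
      (h.path_mem_closedOrthant hi hs').2 e he]
    simp

/-- The path defined by a ladder has speed at most `√(ladderSq k A B p q)`. -/
lemma intrinsicDist_path_le (h : IsLadder k A B t p q) (hX : IsOrthantSpace m X)
    (hO : ∀ i ≤ k, orthant (stage k A B i) ⊆ X) {s s' : ℝ} (hs : 0 ≤ s) (hss' : s ≤ s')
    (hs' : s' ≤ 1) :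
    (ladderPath k A B t p q s ∈ X ∧ ladderPath k A B t p q s' ∈ X) ∧
    intrinsicDist X (ladderPath k A B t p q s) (ladderPath k A B t p q s') ≤
      (s' - s) * √(ladderSq k A B p q) := by
  refine intrinsicDist_le_of_legs hX h.t_le_succ
    (fun i hi s hs => hX.closedOrthant_subset (hO i hi) (h.path_mem_closedOrthant hi hs))
    (fun i hi s hs s' hs' hss' => ?_) k le_rfl s s' (h.t_zero.symm ▸ hs) hss'
    (h.t_last.symm ▸ hs')
  rw [← h.dist_path hi hs hs' hss']
  exact (hX.intrinsicDist_eq_dist (hO i hi) (h.path_mem_closedOrthant hi hs)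
    (h.path_mem_closedOrthant hi hs')).le

lemma intrinsicDist_le (h : IsLadder k A B t p q) (hX : IsOrthantSpace m X)
    (hO : ∀ i ≤ k, orthant (stage k A B i) ⊆ X) :
    intrinsicDist X p q ≤ √(ladderSq k A B p q) := by
  have := (h.intrinsicDist_path_le hX hO le_rfl zero_le_one le_rfl).2
  rwa [h.path_start, h.path_end, sub_zero, one_mul] at this

end IsLadder

/-! ### Ladder velocities as a calibration -/

namespace IsLadder

variable {k : ℕ} {A B : ℕ → Finset (Fin M)} {t : ℕ → ℝ} {p q : Euc M}

lemma sum_univ (h : IsLadder k A B t p q) (g : Fin M → ℝ)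
    (hg : ∀ e, e ∉ A 0 → p e = 0 → q e = 0 → g e = 0) :
    ∑ e, g e = ∑ e ∈ A 0, g e +
      ∑ j ∈ Finset.Icc 1 k, (∑ e ∈ A j, g e + ∑ e ∈ B j, g e) := by
  -- Off the last stage, only axes of `A 1, …, A k` can contribute.
  have h1 : ∑ e ∈ (Finset.Icc 1 k).biUnion A, g e = ∑ e ∈ (stage k A B k)ᶜ, g e := by
    refine Finset.sum_subset (fun e he => ?_) fun e he he' => ?_
    · obtain ⟨j, hj, hej⟩ := Finset.mem_biUnion.1 he
      rw [Finset.mem_Icc] at hj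
      rw [Finset.mem_compl, h.mem_stage_A le_rfl hj.1 hj.2 hej]
      omega
    · rw [Finset.mem_compl] at he
      rcases h.cases_axis e with h0 | ⟨j, hj, hjk, hej⟩ | ⟨j, hj, hjk, hej⟩ | ⟨h0, -, hp, hq⟩
      · exact absurd (mem_stage.2 (Or.inl h0)) he
      · exact absurd (Finset.mem_biUnion.2 ⟨j, Finset.mem_Icc.2 ⟨hj, hjk⟩, hej⟩) he'
      · exact absurd ((h.mem_stage_B le_rfl hj hjk hej).2 hjk) he
      · exact hg e h0 hp hq
  have h2 : ∑ e ∈ (Finset.Icc 1 k).biUnion A, g e = ∑ j ∈ Finset.Icc 1 k, ∑ e ∈ A j, g e := by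
    refine Finset.sum_biUnion fun a ha b hb hab => ?_
    simp only [Finset.coe_Icc, Set.mem_Icc] at ha hb
    exact h.disjAA a ha.2 b hb.2 hab
  rw [← Finset.sum_add_sum_compl (stage k A B k), ← h1, h2, h.sum_stage le_rfl,
    Finset.Icc_eq_empty (by omega : ¬ k + 1 ≤ k), Finset.sum_empty, Finset.sum_add_distrib]
  ring

/-- The calibrating functional takes the value length squared on `q - p`: block `j` contributes
`a_j² / t_j + b_j² / (1 - t_j) = (a_j + b_j)²`. -/
lemma sum_velocity_mul (h : IsLadder k A B t p q)
    (ht : ∀ j, 1 ≤ j → j ≤ k → 0 < t j ∧ t j < 1) :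
    ∑ e, ladderVelocity k A B t p q e * (q e - p e) = ladderSq k A B p q := by
  rw [h.sum_univ _ fun e _ hp hq => by simp [hp, hq], ladderSq, norm_proj_sq]
  congr 1
  · refine Finset.sum_congr rfl fun e he => ?_
    rw [h.velocity_zero he, PiLp.sub_apply, sq]
  · refine Finset.sum_congr rfl fun j hj => ?_
    rw [Finset.mem_Icc] at hj
    obtain ⟨h0, h1⟩ := ht j hj.1 hj.2
    have hA : ∑ e ∈ A j, ladderVelocity k A B t p q e * (q e - p e)
        = ‖proj (A j) p‖ ^ 2 / t j := by
      rw [norm_proj_sq, Finset.sum_div]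
      refine Finset.sum_congr rfl fun e he => ?_
      rw [h.velocity_A hj.1 hj.2 he, h.q_eq_zero hj.1 hj.2 he]
      ring
    have hB : ∑ e ∈ B j, ladderVelocity k A B t p q e * (q e - p e)
        = ‖proj (B j) q‖ ^ 2 / (1 - t j) := by
      rw [norm_proj_sq, Finset.sum_div]
      refine Finset.sum_congr rfl fun e he => ?_
      rw [h.velocity_B hj.1 hj.2 he, h.p_eq_zero hj.1 hj.2 he]
      ring
    have h2 : ‖proj (A j) p‖ ^ 2 / t j
        = ‖proj (A j) p‖ * (‖proj (A j) p‖ + ‖proj (B j) q‖) := by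
      rw [div_eq_iff h0.ne', mul_assoc, mul_comm _ (t j), ← h.balance j hj.1 hj.2, sq]
    have h3 : ‖proj (B j) q‖ ^ 2 / (1 - t j)
        = ‖proj (B j) q‖ * (‖proj (A j) p‖ + ‖proj (B j) q‖) := by
      rw [div_eq_iff (by linarith), mul_assoc, mul_comm _ (1 - t j), ← h.balance' hj.1 hj.2, sq]
    rw [hA, hB, h2, h3]
    ring

/-- Reduces the norm bound on an orthant to one inequality for each exchange `A j`, `B j`; axes of
`A 0` can only help when they are missing from `E`. -/
lemma sum_velocity_sq_le (h : IsLadder k A B t p q) {E : Finset (Fin M)}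
    (hE : ∀ j, 1 ≤ j → j ≤ k →
      ‖proj (A j ∩ E) p‖ ^ 2 / t j ^ 2 + ‖proj (B j ∩ E) q‖ ^ 2 / (1 - t j) ^ 2 ≤
        (‖proj (A j) p‖ + ‖proj (B j) q‖) ^ 2) :
    ∑ e ∈ E, ladderVelocity k A B t p q e ^ 2 ≤ ladderSq k A B p q := by
  have h1 : ∑ e ∈ E, ladderVelocity k A B t p q e ^ 2
      = ∑ e, if e ∈ E then ladderVelocity k A B t p q e ^ 2 else 0 := by simp
  rw [h1, h.sum_univ _ fun e he hp hq => by simp [ladderVelocity, he, hp, hq], ladderSq]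
  refine add_le_add ?_ (Finset.sum_le_sum fun j hj => ?_)
  · rw [norm_proj_sq]
    refine Finset.sum_le_sum fun e he => ?_
    rw [h.velocity_zero he, PiLp.sub_apply]
    split_ifs
    · exact le_rfl
    · positivity
  · rw [Finset.mem_Icc] at hj
    rw [← Finset.sum_filter, ← Finset.sum_filter, Finset.filter_mem_eq_inter,
      Finset.filter_mem_eq_inter, h.sum_velocity_sq_A hj.1 hj.2 Finset.inter_subset_left,
      h.sum_velocity_sq_B hj.1 hj.2 Finset.inter_subset_left]
    exact hE j hj.1 hj.2

/-- If the velocities of a ladder path have norm at most the speed of the path on each orthant of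
`X`, then this path is a geodesic. -/
lemma isGeodesic (h : IsLadder k A B t p q) (hX : IsOrthantSpace m X)
    (hO : ∀ i ≤ k, orthant (stage k A B i) ⊆ X) (ht : ∀ j, 1 ≤ j → j ≤ k → 0 < t j ∧ t j < 1)
    (hpos : 0 < ladderSq k A B p q)
    (hE : ∀ E : Finset (Fin M), orthant E ⊆ X →
      ∑ e ∈ E, ladderVelocity k A B t p q e ^ 2 ≤ ladderSq k A B p q) :
    IsGeodesic X p q (ladderPath k A B t p q) := by
  set γ := ladderPath k A B t p q
  have hmem : ∀ s ∈ Set.Icc (0 : ℝ) 1, γ s ∈ X := fun s hs =>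
    (h.intrinsicDist_path_le hX hO hs.1 le_rfl hs.2).1.1
  have hp : p ∈ X := h.path_start ▸ hmem 0 ⟨le_rfl, zero_le_one⟩
  have hq : q ∈ X := h.path_end ▸ hmem 1 ⟨zero_le_one, le_rfl⟩
  set l := √(ladderSq k A B p q)
  have hl : 0 < l := Real.sqrt_pos.2 hpos
  have hl2 : l ^ 2 = ladderSq k A B p q := Real.sq_sqrt hpos.le
  have hdist : intrinsicDist X p q = l := by
    refine le_antisymm (h.intrinsicDist_le hX hO) ?_
    -- Calibration: `l² = ⟨v, q - p⟩ ≤ l · d(p, q)`.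
    have h1 := hX.sum_mul_sub_le (ladderVelocity k A B t p q) hl
      (fun E hEX => by rw [hl2]; exact hE E hEX) hp hq
    rw [h.sum_velocity_mul ht, ← hl2, sq] at h1
    exact le_of_mul_le_mul_left h1 hl
  have key : ∀ s s', 0 ≤ s → s ≤ s' → s' ≤ 1 → intrinsicDist X (γ s) (γ s') = (s' - s) * l := by
    intro s s' hs hss' hs'
    obtain ⟨⟨hm, hm'⟩, hle⟩ := h.intrinsicDist_path_le hX hO hs hss' hs'
    refine le_antisymm hle ?_
    -- The three subpaths obey the upper speed bound and their distances add up to at least `l`, so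
    -- none of the bounds is strict.
    have h1 := (h.intrinsicDist_path_le hX hO le_rfl hs (hss'.trans hs')).2
    have h2 := (h.intrinsicDist_path_le hX hO (hs.trans hss') hs' le_rfl).2
    rw [h.path_start] at h1
    rw [h.path_end] at h2
    have h3 := hX.intrinsicDist_triangle hp hm hm'
    have h4 := hX.intrinsicDist_triangle hp hm' hq
    change _ ≤ intrinsicDist X (γ s) (γ s')
    change intrinsicDist X p (γ s) ≤ (s - 0) * l at h1
    change intrinsicDist X (γ s') q ≤ (1 - s') * l at h2
    change intrinsicDist X p (γ s') ≤ intrinsicDist X p (γ s) + intrinsicDist X (γ s) (γ s') at h3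
    change _ ≤ intrinsicDist X p (γ s') + intrinsicDist X (γ s') q at h4
    linarith
  refine ⟨h.path_start, h.path_end, hmem, fun s hs s' hs' => ?_⟩
  rw [hdist]
  rcases le_total s s' with hss' | hss'
  · rw [key s s' hs.1 hss' hs'.2, abs_sub_comm, abs_of_nonneg (sub_nonneg.2 hss')]
  · rw [hX.intrinsicDist_comm (hmem s hs) (hmem s' hs'), key s' s hs'.1 hss' hs.2,
      abs_of_nonneg (sub_nonneg.2 hss')]

/-- The carrier of a non-degenerate ladder path. -/
lemma hasCarrier (h : IsLadder k A B t p q) (hk : 0 < k)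
    (ht : ∀ i ≤ k, t i < t (i + 1)) (hne : ∀ i, 1 ≤ i → i ≤ k → (A i).Nonempty)
    (hp : ∀ j, 1 ≤ j → j ≤ k → ∀ e ∈ A j, 0 < p e)
    (hq : ∀ j, 1 ≤ j → j ≤ k → ∀ e ∈ B j, 0 < q e)
    (h0 : ∀ e ∈ A 0, 0 < p e ∨ 0 < q e) :
    HasCarrier (ladderPath k A B t p q) k (stage k A B) := by
  refine ⟨fun heq => ?_, h.stage_injOn hne, t, h.t_zero, h.t_last, fun i hi => ⟨ht i hi, ?_⟩⟩
  · rw [h.path_start, h.path_end] at heq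
    obtain ⟨e, he⟩ := hne 1 le_rfl hk
    have h1 := hp 1 le_rfl hk e he
    rw [heq, h.q_eq_zero le_rfl hk he] at h1
    exact lt_irrefl _ h1
  · intro s hs
    have hs0 : 0 < s := (h.t_nonneg (by omega)).trans_lt hs.1
    have hs1 : s < 1 := hs.2.trans_le (h.t_le_one (by omega))
    refine ⟨fun e he => ?_,
      (h.path_mem_closedOrthant hi (Set.Ioo_subset_Icc_self hs)).2⟩
    rcases h.cases_axis e with he0 | ⟨j, hj, hjk, hej⟩ | ⟨j, hj, hjk, hej⟩ | ⟨-, hout, -, -⟩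
    · rw [h.path_zero he0]
      have h1 : 0 < 1 - s := by linarith
      have h2 := h.p_nonneg e
      have h3 := h.q_nonneg e
      rcases h0 e he0 with h4 | h4 <;> positivity
    · rw [h.mem_stage_A hi hj hjk hej] at he
      have h1 : s < t j := hs.2.trans_le (h.t_mono he (by omega))
      rw [h.path_A hj hjk hej h1.le]
      have h2 : s / t j < 1 := (div_lt_one (hs0.trans h1)).2 h1
      exact mul_pos (hp j hj hjk e hej) (by linarith)
    · rw [h.mem_stage_B hi hj hjk hej] at he
      have h1 : t j < s := (h.t_mono he (by omega)).trans_lt hs.1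
      rw [h.path_B hj hjk hej h1.le]
      exact mul_pos (hq j hj hjk e hej) (div_pos (by linarith) (by linarith))
    · exact absurd (hout i he) (by omega)

end IsLadder

/-! ### Sufficiency: refined stages and the bound on each orthant -/

lemma mem_refinedStage {k i : ℕ} {A B : ℕ → Finset (Fin M)} {D C : Finset (Fin M)} {e : Fin M} :
    e ∈ refinedStage k A B i D C ↔
      (∃ j < i, e ∈ B j) ∨ e ∈ D ∨ e ∈ C ∨ ∃ j, i + 1 ≤ j ∧ j ≤ k ∧ e ∈ A j := by
  simp only [refinedStage, Finset.mem_union, Finset.mem_biUnion, Finset.mem_range, Finset.mem_Icc,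
    or_assoc, and_assoc]

lemma refinedStage_subset_of_left {k i : ℕ} {A B : ℕ → Finset (Fin M)} (h0 : B 0 = A 0)
    (hi : 1 ≤ i) (hik : i ≤ k) {C : Finset (Fin M)} (hC : C ⊆ A i) :
    refinedStage k A B i ∅ C ⊆ stage k A B (i - 1) := by
  intro e he
  rcases mem_refinedStage.1 he with ⟨j, hj, hej⟩ | hej | hej | ⟨j, hj, hjk, hej⟩
  · rcases Nat.eq_zero_or_pos j with rfl | hj0
    · exact mem_stage.2 (Or.inl (h0 ▸ hej))
    · exact mem_stage.2 (Or.inr (Or.inl ⟨j, hj0, by omega, hej⟩))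
  · exact absurd hej (Finset.notMem_empty e)
  · exact mem_stage.2 (Or.inr (Or.inr ⟨i, by omega, hik, hC hej⟩))
  · exact mem_stage.2 (Or.inr (Or.inr ⟨j, by omega, hjk, hej⟩))

lemma refinedStage_subset_of_right {k i : ℕ} {A B : ℕ → Finset (Fin M)} (h0 : B 0 = A 0)
    (hi : 1 ≤ i) {D : Finset (Fin M)} (hD : D ⊆ B i) :
    refinedStage k A B i D ∅ ⊆ stage k A B i := by
  intro e he
  rcases mem_refinedStage.1 he with ⟨j, hj, hej⟩ | hej | hej | ⟨j, hj, hjk, hej⟩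
  · rcases Nat.eq_zero_or_pos j with rfl | hj0
    · exact mem_stage.2 (Or.inl (h0 ▸ hej))
    · exact mem_stage.2 (Or.inr (Or.inl ⟨j, hj0, hj.le, hej⟩))
  · exact mem_stage.2 (Or.inr (Or.inl ⟨i, hi, le_rfl, hD hej⟩))
  · exact absurd hej (Finset.notMem_empty e)
  · exact mem_stage.2 (Or.inr (Or.inr ⟨j, hj, hjk, hej⟩))

/-- The part in `A i ∪ B i` of an orthant of `X` defines a refined stage in `X`. -/
lemma IsOrthantSpace.orthant_refinedStage_subset (hX : IsOrthantSpace m X) {k i : ℕ}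
    {A B : ℕ → Finset (Fin M)} (h0 : B 0 = A 0) (hi : 1 ≤ i) (hik : i ≤ k)
    (hdisj : Disjoint (A i) (B i)) (hO : ∀ i ≤ k, orthant (stage k A B i) ⊆ X)
    {E : Finset (Fin M)} (hE : orthant E ⊆ X) :
    orthant (refinedStage k A B i (B i ∩ E) (A i ∩ E)) ⊆ X := by
  -- A face without axes of `B i ∩ E` lies in stage `i - 1`, and below one without axes of `A i ∩ E`
  -- lies in stage `i`. Only mixed pairs remain for the flag condition, and these are faces of `E`.
  have hleft : ∀ F ⊆ refinedStage k A B i (B i ∩ E) (A i ∩ E), (∀ e ∈ F, e ∉ B i ∩ E) →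
      orthant F ⊆ X := by
    refine fun F hF hFB => hX.orthant_subset_of_subset (hO (i - 1) (by omega))
      (subset_trans (fun e he => ?_)
        (refinedStage_subset_of_left h0 hi hik (C := A i ∩ E) Finset.inter_subset_left))
    have h1 := hF he
    rw [mem_refinedStage] at h1 ⊢
    exact h1.imp_right fun h2 => Or.inr (h2.resolve_left (hFB e he))
  have hright : ∀ F ⊆ refinedStage k A B i (B i ∩ E) (A i ∩ E), (∀ e ∈ F, e ∉ A i ∩ E) →
      orthant F ⊆ X := by
    refine fun F hF hFA => hX.orthant_subset_of_subset (hO i hik)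
      (subset_trans (fun e he => ?_)
        (refinedStage_subset_of_right h0 hi (D := B i ∩ E) Finset.inter_subset_left))
    have h1 := hF he
    rw [mem_refinedStage] at h1 ⊢
    exact h1.imp_right fun h2 => h2.imp_right fun h3 => Or.inr (h3.resolve_left (hFA e he))
  by_cases hB : ∀ e ∈ refinedStage k A B i (B i ∩ E) (A i ∩ E), e ∉ B i ∩ E
  · exact hleft _ subset_rfl hB
  by_cases hA : ∀ e ∈ refinedStage k A B i (B i ∩ E) (A i ∩ E), e ∉ A i ∩ E
  · exact hright _ subset_rfl hA
  push Not at hA hB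
  obtain ⟨a, ha, haA⟩ := hA
  obtain ⟨b, hb, hbB⟩ := hB
  refine hX.flag _ (Finset.one_lt_card.2 ⟨a, ha, b, hb, fun hab => ?_⟩) fun F hF hFcl => ?_
  · exact Finset.disjoint_left.1 hdisj (Finset.mem_inter.1 haA).1
      (hab ▸ (Finset.mem_inter.1 hbB).1)
  have hFsub := subset_of_orthant_subset_closure hFcl
  by_cases hFB : ∀ e ∈ F, e ∉ B i ∩ E
  · exact hleft F hFsub hFB
  by_cases hFA : ∀ e ∈ F, e ∉ A i ∩ E
  · exact hright F hFsub hFA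
  push Not at hFA hFB
  obtain ⟨c, hc, hcA⟩ := hFA
  obtain ⟨d, hd, hdB⟩ := hFB
  rw [Finset.mem_inter] at hcA hdB
  have hcd : c ≠ d := fun hcd => Finset.disjoint_left.1 hdisj hcA.1 (hcd ▸ hdB.1)
  have hF2 : {c, d} = F := by
    refine Finset.eq_of_subset_of_card_le
      (Finset.insert_subset hc (Finset.singleton_subset_iff.2 hd)) ?_
    rw [hF, Finset.card_pair hcd]
  refine hX.orthant_subset_of_subset hE ?_
  rw [← hF2]
  exact Finset.insert_subset hcA.2 (Finset.singleton_subset_iff.2 hdB.2)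

/-- After clearing denominators the claim is `c₂² b² + d₁² a² ≤ a² b²`. Substituting the
decompositions of `a²` and `b²` reduces it to `(c₂ d₁)² ≤ (c₁ d₂)²`, so the condition on the ratios
is exactly the calibration bound. -/
lemma sq_div_sq_add_sq_div_sq_le {a b c₁ c₂ d₁ d₂ : ℝ} (ha : 0 < a) (hb : 0 < b)
    (hc₂ : 0 ≤ c₂) (hd₁ : 0 ≤ d₁)
    (hac : a ^ 2 = c₁ ^ 2 + c₂ ^ 2) (hbd : b ^ 2 = d₁ ^ 2 + d₂ ^ 2) (h : c₂ * d₁ ≤ c₁ * d₂) :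
    c₂ ^ 2 / (a / (a + b)) ^ 2 + d₁ ^ 2 / (1 - a / (a + b)) ^ 2 ≤ (a + b) ^ 2 := by
  have h1 : 1 - a / (a + b) = b / (a + b) := by
    field_simp
    ring
  have h2 : c₂ ^ 2 / (a / (a + b)) ^ 2 + d₁ ^ 2 / (b / (a + b)) ^ 2
      = (a + b) ^ 2 * ((c₂ ^ 2 * b ^ 2 + d₁ ^ 2 * a ^ 2) / (a ^ 2 * b ^ 2)) := by
    field_simp
  have h3 : (c₂ * d₁) ^ 2 ≤ (c₁ * d₂) ^ 2 := pow_le_pow_left₀ (by positivity) h 2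
  rw [h1, h2]
  refine mul_le_of_le_one_right (by positivity) ((div_le_one (by positivity)).2 ?_)
  rw [hac, hbd]
  nlinarith [h3]

/-- Sufficiency of the conditions on the ratios. -/
theorem isSupport_of_ratio (hX : IsOrthantSpace m X) {p q : Euc M} (hp : p ∈ X) (hq : q ∈ X)
    {k : ℕ} (hk : 0 < k) {A B : ℕ → Finset (Fin M)} (h0 : B 0 = A 0)
    (h0pq : ∀ e ∈ A 0, 0 < p e ∨ 0 < q e)
    (hO : ∀ i ≤ k, orthant (stage k A B i) ⊆ X)
    (hne : ∀ i, 1 ≤ i → i ≤ k → (A i).Nonempty ∧ (B i).Nonempty)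
    (hAA : ∀ i ≤ k, ∀ j ≤ k, i ≠ j → Disjoint (A i) (A j))
    (hBB : ∀ i ≤ k, ∀ j ≤ k, i ≠ j → Disjoint (B i) (B j))
    (hAB : ∀ i ≤ k, ∀ j ≤ k, (i ≠ 0 ∨ j ≠ 0) → Disjoint (A i) (B j))
    (hA : (Finset.Icc 1 k).biUnion A = posAxes p \ A 0)
    (hB : (Finset.Icc 1 k).biUnion B = posAxes q \ B 0)
    (h1 : ∀ i, 0 < i → i < k → ratio p q (A i) (B i) < ratio p q (A (i + 1)) (B (i + 1)))
    (h2 : ∀ i, 0 < i → i ≤ k → ∀ C₁ C₂ D₁ D₂ : Finset (Fin M),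
      Disjoint C₁ C₂ → C₁ ∪ C₂ = A i → Disjoint D₁ D₂ → D₁ ∪ D₂ = B i →
      (C₁ ∪ D₁).Nonempty → (C₂ ∪ D₂).Nonempty →
      orthant (refinedStage k A B i D₁ C₂) ⊆ X → ratio p q C₂ D₂ ≤ ratio p q C₁ D₁) :
    IsSupport X p q k A B := by
  have hpA : ∀ j, 1 ≤ j → j ≤ k → ∀ e ∈ A j, 0 < p e := fun j hj hjk e he => by
    have := hA.subset (Finset.mem_biUnion.2 ⟨j, Finset.mem_Icc.2 ⟨hj, hjk⟩, he⟩)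
    exact mem_posAxes.1 (Finset.mem_sdiff.1 this).1
  have hqB : ∀ j, 1 ≤ j → j ≤ k → ∀ e ∈ B j, 0 < q e := fun j hj hjk e he => by
    have := hB.subset (Finset.mem_biUnion.2 ⟨j, Finset.mem_Icc.2 ⟨hj, hjk⟩, he⟩)
    exact mem_posAxes.1 (Finset.mem_sdiff.1 this).1
  have hp0 : ∀ e, e ∉ stage k A B 0 → p e = 0 := by
    intro e he
    by_contra hpe
    refine he (mem_stage.2 ?_)
    by_cases heA : e ∈ A 0
    · exact Or.inl heA
    · have hpos := mem_posAxes.2 (lt_of_le_of_ne (hX.nonneg hp e) (Ne.symm hpe))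
      obtain ⟨j, hj, hej⟩ := Finset.mem_biUnion.1 (hA.superset (Finset.mem_sdiff.2 ⟨hpos, heA⟩))
      rw [Finset.mem_Icc] at hj
      exact Or.inr (Or.inr ⟨j, by omega, hj.2, hej⟩)
  have hq0 : ∀ e, e ∉ stage k A B k → q e = 0 := by
    intro e he
    by_contra hqe
    refine he (mem_stage.2 ?_)
    by_cases heA : e ∈ A 0
    · exact Or.inl heA
    · have hpos := mem_posAxes.2 (lt_of_le_of_ne (hX.nonneg hq e) (Ne.symm hqe))
      obtain ⟨j, hj, hej⟩ :=
        Finset.mem_biUnion.1 (hB.superset (Finset.mem_sdiff.2 ⟨hpos, h0 ▸ heA⟩))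
      rw [Finset.mem_Icc] at hj
      exact Or.inr (Or.inl ⟨j, hj.1, hj.2, hej⟩)
  have ha : ∀ j, 1 ≤ j → j ≤ k → 0 < ‖proj (A j) p‖ := fun j hj hjk =>
    norm_proj_pos (fun e he => (hpA j hj hjk e he).ne') (hne j hj hjk).1
  have hb : ∀ j, 1 ≤ j → j ≤ k → 0 < ‖proj (B j) q‖ := fun j hj hjk =>
    norm_proj_pos (fun e he => (hqB j hj hjk e he).ne') (hne j hj hjk).2
  obtain ⟨t, ht0, htl, htj⟩ : ∃ t : ℕ → ℝ, t 0 = 0 ∧ t (k + 1) = 1 ∧ ∀ j, 1 ≤ j → j ≤ k →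
      t j = ‖proj (A j) p‖ / (‖proj (A j) p‖ + ‖proj (B j) q‖) := by
    refine ⟨fun j => if j = 0 then 0 else if j ≤ k then
      ‖proj (A j) p‖ / (‖proj (A j) p‖ + ‖proj (B j) q‖) else 1, by simp, by simp, ?_⟩
    intro j hj hjk
    simp only [show j ≠ 0 by omega, hjk, if_false, if_true]
  have ht01 : ∀ j, 1 ≤ j → j ≤ k → 0 < t j ∧ t j < 1 := by
    intro j hj hjk
    have := ha j hj hjk
    have := hb j hj hjk
    rw [htj j hj hjk]
    exact ⟨by positivity, (div_lt_one (by positivity)).2 (by linarith)⟩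
  -- `a / (a + b)` is increasing in `a / b`, so condition (i) orders the interior times.
  have htlt : ∀ i ≤ k, t i < t (i + 1) := by
    intro i hi
    rcases Nat.eq_zero_or_pos i with rfl | hi0
    · rw [ht0]
      exact (ht01 1 le_rfl hk).1
    rcases hi.eq_or_lt with rfl | hik
    · rw [htl]
      exact (ht01 i hi0 hi).2
    have h3 := h1 i hi0 hik
    have hai := ha i hi0 hi
    have hbi := hb i hi0 hi
    have hai' := ha (i + 1) (by omega) hik
    have hbi' := hb (i + 1) (by omega) hik
    rw [ratio_lt_ratio_iff (fun e he => (hpA i hi0 hi e he).ne')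
      (fun e he => (hpA _ (by omega) hik e he).ne') (fun e he => (hqB i hi0 hi e he).ne')
      (fun e he => (hqB _ (by omega) hik e he).ne') ((hne i hi0 hi).1.mono Finset.subset_union_left)
      ((hne (i + 1) (by omega) hik).1.mono Finset.subset_union_left)] at h3
    rw [htj i hi0 hi, htj (i + 1) (by omega) hik, div_lt_div_iff₀ (by positivity) (by positivity)]
    linarith
  have hL : IsLadder k A B t p q :=
    { disjAA := hAA
      disjBB := fun i j _ hi _ hj hij => hBB i hi j hj hij
      disjAB := fun i hi j hj hjk => hAB i hi j hjk (Or.inr (by omega))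
      t_zero := ht0
      t_last := htl
      t_le_succ := fun i hi => (htlt i hi).le
      p_nonneg := hX.nonneg hp
      q_nonneg := hX.nonneg hq
      p_zero := hp0
      q_zero := hq0
      balance := fun j hj hjk => by
        have := ha j hj hjk
        have := hb j hj hjk
        rw [htj j hj hjk, div_mul_cancel₀ _ (by positivity)] }
  refine ⟨ladderPath k A B t p q, hL.isGeodesic hX hO ht01 ?_ fun E hE => ?_,
    hL.hasCarrier hk htlt (fun i hi hik => (hne i hi hik).1) hpA hqB h0pq⟩
  · refine add_pos_of_nonneg_of_pos (sq_nonneg _) (Finset.sum_pos (fun j hj => ?_)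
      ⟨1, Finset.mem_Icc.2 ⟨le_rfl, hk⟩⟩)
    rw [Finset.mem_Icc] at hj
    have := ha j hj.1 hj.2
    positivity
  · refine hL.sum_velocity_sq_le fun j hj hjk => ?_
    -- Decomposition for (ii): `C₁ = A j \ E`, `C₂ = A j ∩ E`, `D₁ = B j ∩ E`, `D₂ = B j \ E`.
    have hdA : Disjoint (A j \ E) (A j ∩ E) := Finset.disjoint_sdiff_inter _ _
    have hdB : Disjoint (B j ∩ E) (B j \ E) := (Finset.disjoint_sdiff_inter _ _).symm
    have huA : A j \ E ∪ A j ∩ E = A j := Finset.sdiff_union_inter _ _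
    have huB : B j ∩ E ∪ B j \ E = B j := by rw [Finset.union_comm, Finset.sdiff_union_inter]
    rw [htj j hj hjk]
    refine sq_div_sq_add_sq_div_sq_le (c₁ := ‖proj (A j \ E) p‖)
      (d₂ := ‖proj (B j \ E) q‖) (ha j hj hjk) (hb j hj hjk) (norm_nonneg _) (norm_nonneg _)
      ?_ ?_ ?_
    · rw [← norm_proj_union_sq hdA, huA]
    · rw [← norm_proj_union_sq hdB, huB]
    · have hempty : ∀ x : Euc M, ‖proj ∅ x‖ = 0 := fun x => by
        rw [← sq_eq_zero_iff, norm_proj_sq, Finset.sum_empty]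
      -- Condition (ii) does not cover decompositions with an empty side; there `c₂ d₁ = 0` and the
      -- inequality is trivial.
      rcases (A j \ E ∪ B j ∩ E).eq_empty_or_nonempty with hC | hC
      · rw [(Finset.union_eq_empty.1 hC).2, hempty, mul_zero]
        positivity
      rcases (A j ∩ E ∪ B j \ E).eq_empty_or_nonempty with hD | hD
      · rw [(Finset.union_eq_empty.1 hD).1, hempty, zero_mul]
        positivity
      have h3 := h2 j hj hjk _ _ _ _ hdA huA hdB huB hC hD
        (hX.orthant_refinedStage_subset h0 hj hjk (hAB j hjk j hjk (Or.inl (by omega))) hO hE)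
      rw [← not_lt, ratio_lt_ratio_iff
        (fun e he => (hpA j hj hjk e (Finset.sdiff_subset he)).ne')
        (fun e he => (hpA j hj hjk e (Finset.inter_subset_left he)).ne')
        (fun e he => (hqB j hj hjk e (Finset.inter_subset_left he)).ne')
        (fun e he => (hqB j hj hjk e (Finset.sdiff_subset he)).ne') hC hD, not_lt] at h3
      exact h3

/-! ### Necessity: geodesics are straight on legs and unrefracted at crossings -/

/-- A curve of constant speed on an interval is affine. -/
lemma exists_velocity_of_dist_eq {γ : ℝ → Euc M} {a b l : ℝ} (hab : a < b)
    (h : ∀ s ∈ Set.Icc a b, ∀ s' ∈ Set.Icc a b, dist (γ s) (γ s') = |s - s'| * l) :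
    ∃ v : Euc M, ‖v‖ = l ∧ ∀ s ∈ Set.Icc a b, ∀ s' ∈ Set.Icc a b, ∀ e,
      γ s' e - γ s e = (s' - s) * v e := by
  have hba : 0 < b - a := sub_pos.2 hab
  have ha : a ∈ Set.Icc a b := ⟨le_rfl, hab.le⟩
  have hb : b ∈ Set.Icc a b := ⟨hab.le, le_rfl⟩
  have hd : dist (γ a) (γ b) = (b - a) * l := by
    rw [h a ha b hb, abs_sub_comm, abs_of_pos hba]
  -- Equality in the triangle inequality, in a strictly convex space, determines the point on the
  -- segment.
  have key : ∀ s ∈ Set.Icc a b, γ s = AffineMap.lineMap (γ a) (γ b) ((s - a) / (b - a)) := by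
    intro s hs
    refine eq_lineMap_of_dist_eq_mul_of_dist_eq_mul ?_ ?_
    · rw [h a ha s hs, hd, abs_sub_comm, abs_of_nonneg (sub_nonneg.2 hs.1)]
      field_simp
    · rw [h s hs b hb, hd, abs_sub_comm, abs_of_nonneg (sub_nonneg.2 hs.2)]
      field_simp
      ring
  refine ⟨(b - a)⁻¹ • (γ b - γ a), ?_, fun s hs s' hs' e => ?_⟩
  · rw [norm_smul, ← dist_eq_norm, dist_comm, hd, Real.norm_of_nonneg (inv_nonneg.2 hba.le),
      inv_mul_cancel_left₀ hba.ne']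
  · rw [key s hs, key s' hs']
    simp only [AffineMap.lineMap_apply, vsub_eq_sub, vadd_eq_add, PiLp.add_apply, PiLp.smul_apply,
      PiLp.sub_apply, smul_eq_mul]
    field_simp
    ring

/-- If a shortest path crosses from one orthant to another at the midpoint of its two straight
pieces, then the common coordinates have the same velocity on both sides. -/
lemma eq_of_two_mul_le_intrinsicDist (hX : IsOrthantSpace m X) {E F : Finset (Fin M)}
    (hE : orthant E ⊆ X) (hF : orthant F ⊆ X) {p c q : Euc M} {r : ℝ} (hp : p ∈ closedOrthant E)
    (hcE : c ∈ closedOrthant E) (hcF : c ∈ closedOrthant F) (hq : q ∈ closedOrthant F)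
    (hpc : dist p c = r) (hcq : dist c q = r) (hr : 2 * r ≤ intrinsicDist X p q)
    {e : Fin M} (heE : e ∈ E) (heF : e ∈ F) : c e - p e = q e - c e := by
  -- The competing crossing point: the midpoint of `p` and `q` projected to the common face, which
  -- minimises the sum of squared distances to `p` and `q` there.
  let c' : Euc M := WithLp.toLp 2 fun e => if e ∈ E ∧ e ∈ F then (p e + q e) / 2 else 0
  have hc0 : ∀ e, 0 ≤ c' e := fun e => by
    have := hp.1 e
    have := hq.1 e
    simp only [c']
    split_ifs <;> positivity
  have hc'E : c' ∈ closedOrthant E := ⟨hc0, fun e he => by simp [c', he]⟩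
  have hc'F : c' ∈ closedOrthant F := ⟨hc0, fun e he => by simp [c', he]⟩
  have h1 : 2 * r ≤ dist p c' + dist c' q := by
    refine hr.trans ?_
    rw [← hX.intrinsicDist_eq_dist hE hp hc'E, ← hX.intrinsicDist_eq_dist hF hc'F hq]
    exact hX.intrinsicDist_triangle (hX.closedOrthant_subset hE hp)
      (hX.closedOrthant_subset hE hc'E) (hX.closedOrthant_subset hF hq)
  have hr0 : 0 ≤ r := hpc ▸ dist_nonneg
  -- Two numbers with sum at least `2r` have squares summing to at least `2r²`; the equal distances
  -- at `c` turn the length comparison into one of squares.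
  have h2 : dist p c ^ 2 + dist c q ^ 2 ≤ dist p c' ^ 2 + dist c' q ^ 2 := by
    rw [hpc, hcq]
    nlinarith [sq_nonneg (dist p c' - dist c' q)]
  have hterm : ∀ e, (if e ∈ E ∧ e ∈ F then (p e + q e - 2 * c e) ^ 2 / 2 else 0)
      = (p e - c e) ^ 2 + (c e - q e) ^ 2 - (p e - c' e) ^ 2 - (c' e - q e) ^ 2 := by
    intro e
    by_cases he : e ∈ E ∧ e ∈ F
    · simp only [c', he, and_self, if_true]
      ring
    · have hce : c e = 0 := by
        by_cases heE : e ∈ E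
        · exact hcF.2 e fun h => he ⟨heE, h⟩
        · exact hcE.2 e heE
      simp only [c', he, if_false, hce]
      ring
  have h3 : ∑ e, (if e ∈ E ∧ e ∈ F then (p e + q e - 2 * c e) ^ 2 / 2 else 0) ≤ 0 := by
    simp only [dist_eq_norm, EuclideanSpace.real_norm_sq_eq, PiLp.sub_apply] at h2
    rw [Finset.sum_congr rfl fun e _ => hterm e, Finset.sum_sub_distrib, Finset.sum_sub_distrib,
      Finset.sum_add_distrib]
    linarith
  have h4 := (Finset.single_le_sum (f := fun e =>
    if e ∈ E ∧ e ∈ F then (p e + q e - 2 * c e) ^ 2 / 2 else 0)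
    (fun e _ => by dsimp only; split_ifs <;> positivity) (Finset.mem_univ e)).trans h3
  simp only [heE, heF, and_self, if_true] at h4
  have h5 : (p e + q e - 2 * c e) ^ 2 = 0 := le_antisymm (by linarith) (sq_nonneg _)
  have h6 := pow_eq_zero_iff two_ne_zero |>.1 h5
  linarith

section Crossing

variable {x y : Euc M} {γ : ℝ → Euc M}

lemma IsGeodesic.dist_le (hX : IsOrthantSpace m X) (hγ : IsGeodesic X x y γ) {s s' : ℝ}
    (hs : s ∈ Set.Icc (0 : ℝ) 1) (hs' : s' ∈ Set.Icc (0 : ℝ) 1) :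
    dist (γ s) (γ s') ≤ |s - s'| * intrinsicDist X x y := by
  rw [← hγ.2.2.2 s hs s' hs']
  exact hX.dist_le_intrinsicDist (hγ.2.2.1 s hs) (hγ.2.2.1 s' hs')

lemma IsGeodesic.continuousOn (hX : IsOrthantSpace m X) (hγ : IsGeodesic X x y γ) :
    ContinuousOn γ (Set.Icc 0 1) := by
  have : LipschitzOnWith (Real.toNNReal (intrinsicDist X x y)) γ (Set.Icc 0 1) := by
    refine LipschitzOnWith.of_dist_le_mul fun s hs s' hs' => ?_
    rw [Real.dist_eq, mul_comm]
    exact (hγ.dist_le hX hs hs').trans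
      (mul_le_mul_of_nonneg_left (Real.le_coe_toNNReal _) (abs_nonneg _))
  exact this.continuousOn

lemma IsGeodesic.mem_closedOrthant (hX : IsOrthantSpace m X) (hγ : IsGeodesic X x y γ)
    {a b : ℝ} (ha : 0 ≤ a) (hb : b ≤ 1) (hab : a < b) {E : Finset (Fin M)}
    (h : ∀ s ∈ Set.Ioo a b, γ s ∈ orthant E) {s : ℝ} (hs : s ∈ Set.Icc a b) :
    γ s ∈ closedOrthant E := by
  rw [← closure_Ioo hab.ne] at hs
  have hcont : ContinuousWithinAt γ (Set.Ioo a b) s :=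
    (hγ.continuousOn hX s (Set.Icc_subset_Icc ha hb (closure_Ioo hab.ne ▸ hs))).mono
      (Set.Ioo_subset_Icc_self.trans (Set.Icc_subset_Icc ha hb))
  exact closure_minimal (orthant_subset_closedOrthant E) (isClosed_closedOrthant E)
    (hcont.mem_closure hs h)

variable {k : ℕ} {A B : ℕ → Finset (Fin M)} {t : ℕ → ℝ}

/-- The velocities on the legs of a curve through the orthants `stage k A B i`. -/
structure IsCrossing (X : Set (Euc M)) (k : ℕ) (A B : ℕ → Finset (Fin M)) (t : ℕ → ℝ)
    (γ : ℝ → Euc M) (l : ℝ) (V : ℕ → Euc M) : Prop extends DisjointAxes k A B where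
  t_zero : t 0 = 0
  t_last : t (k + 1) = 1
  t_lt_succ : ∀ i ≤ k, t i < t (i + 1)
  mem_orthant : ∀ i ≤ k, ∀ s ∈ Set.Ioo (t i) (t (i + 1)), γ s ∈ orthant (stage k A B i)
  mem_closedOrthant : ∀ i ≤ k, ∀ s ∈ Set.Icc (t i) (t (i + 1)),
    γ s ∈ closedOrthant (stage k A B i)
  norm_velocity : ∀ i ≤ k, ‖V i‖ = l
  sub_eq : ∀ i ≤ k, ∀ s ∈ Set.Icc (t i) (t (i + 1)), ∀ s' ∈ Set.Icc (t i) (t (i + 1)), ∀ e,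
    γ s' e - γ s e = (s' - s) * V i e
  velocity_eq : ∀ i < k, ∀ e ∈ stage k A B i, e ∈ stage k A B (i + 1) → V i e = V (i + 1) e
  dist_eq : ∀ s ∈ Set.Icc (0 : ℝ) 1, ∀ s' ∈ Set.Icc (0 : ℝ) 1,
    intrinsicDist X (γ s) (γ s') = |s - s'| * l

/-- By continuity each closed leg stays in one closed orthant, where the intrinsic distance is
Euclidean, so constant speed makes the leg affine. Comparing points at equal times before and after
a breakpoint rules out refraction. -/
lemma IsGeodesic.exists_isCrossing (hX : IsOrthantSpace m X) (hγ : IsGeodesic X x y γ)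
    (hd : DisjointAxes k A B) (hO : ∀ i ≤ k, orthant (stage k A B i) ⊆ X)
    (hc : HasCarrier γ k (stage k A B)) :
    ∃ t V, IsCrossing X k A B t γ (intrinsicDist X x y) V := by
  obtain ⟨-, -, t, ht0, ht1, ht⟩ := hc
  have hle : ∀ i ≤ k, t i ≤ t (i + 1) := fun i hi => (ht i hi).1.le
  have hIcc : ∀ i ≤ k, Set.Icc (t i) (t (i + 1)) ⊆ Set.Icc 0 1 := fun i hi =>
    Set.Icc_subset_Icc (ht0 ▸ le_of_le_succ hle (Nat.zero_le i) (by omega))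
      (ht1 ▸ le_of_le_succ hle (by omega) le_rfl)
  have hmem : ∀ i ≤ k, ∀ s ∈ Set.Icc (t i) (t (i + 1)), γ s ∈ closedOrthant (stage k A B i) :=
    fun i hi s hs => hγ.mem_closedOrthant hX (hIcc i hi ⟨le_rfl, hle i hi⟩).1
      (hIcc i hi ⟨hle i hi, le_rfl⟩).2 (ht i hi).1 (ht i hi).2 hs
  have hdist : ∀ i ≤ k, ∀ s ∈ Set.Icc (t i) (t (i + 1)), ∀ s' ∈ Set.Icc (t i) (t (i + 1)),
      dist (γ s) (γ s') = |s - s'| * intrinsicDist X x y := fun i hi s hs s' hs' => by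
    rw [← hX.intrinsicDist_eq_dist (hO i hi) (hmem i hi s hs) (hmem i hi s' hs')]
    exact hγ.2.2.2 s (hIcc i hi hs) s' (hIcc i hi hs')
  have hV : ∀ i, ∃ v : Euc M, i ≤ k → ‖v‖ = intrinsicDist X x y ∧
      ∀ s ∈ Set.Icc (t i) (t (i + 1)), ∀ s' ∈ Set.Icc (t i) (t (i + 1)), ∀ e,
        γ s' e - γ s e = (s' - s) * v e := by
    intro i
    by_cases hi : i ≤ k
    · obtain ⟨v, hv⟩ := exists_velocity_of_dist_eq (ht i hi).1 (hdist i hi)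
      exact ⟨v, fun _ => hv⟩
    · exact ⟨0, fun h => absurd h hi⟩
  choose V hV using hV
  refine ⟨t, V, ⟨hd, ht0, ht1, fun i hi => (ht i hi).1, fun i hi => (ht i hi).2, hmem,
    fun i hi => (hV i hi).1, fun i hi => (hV i hi).2, fun i hi e he he' => ?_, hγ.2.2.2⟩⟩
  have h1 := (ht i hi.le).1
  have h2 := (ht (i + 1) hi).1
  obtain ⟨ε, hε, hε1, hε2⟩ : ∃ ε, 0 < ε ∧ ε ≤ t (i + 1) - t i ∧ ε ≤ t (i + 1 + 1) - t (i + 1) :=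
    ⟨min (t (i + 1) - t i) (t (i + 1 + 1) - t (i + 1)), lt_min (by linarith) (by linarith),
      min_le_left _ _, min_le_right _ _⟩
  have hp : t (i + 1) - ε ∈ Set.Icc (t i) (t (i + 1)) := ⟨by linarith, by linarith⟩
  have hc : t (i + 1) ∈ Set.Icc (t i) (t (i + 1)) := ⟨h1.le, le_rfl⟩
  have hc' : t (i + 1) ∈ Set.Icc (t (i + 1)) (t (i + 1 + 1)) := ⟨le_rfl, h2.le⟩
  have hq : t (i + 1) + ε ∈ Set.Icc (t (i + 1)) (t (i + 1 + 1)) := ⟨by linarith, by linarith⟩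
  have h3 := eq_of_two_mul_le_intrinsicDist hX (hO i hi.le) (hO (i + 1) hi)
    (r := ε * intrinsicDist X x y) (hmem i hi.le _ hp) (hmem i hi.le _ hc) (hmem (i + 1) hi _ hc')
    (hmem (i + 1) hi _ hq)
    (by rw [hdist i hi.le _ hp _ hc, sub_sub_cancel_left, abs_neg, abs_of_pos hε])
    (by rw [hdist (i + 1) hi _ hc' _ hq, sub_add_cancel_left, abs_neg, abs_of_pos hε])
    (by
      rw [hγ.2.2.2 _ (hIcc i hi.le hp) _ (hIcc (i + 1) hi hq),
        show t (i + 1) - ε - (t (i + 1) + ε) = -(2 * ε) by ring, abs_neg,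
        abs_of_pos (by positivity), mul_assoc]) he he'
  rw [(hV i hi.le).2 _ hp _ hc, (hV (i + 1) hi).2 _ hc' _ hq, sub_sub_cancel,
    add_sub_cancel_left] at h3
  exact mul_left_cancel₀ hε.ne' h3

end Crossing

namespace IsCrossing

variable {k : ℕ} {A B : ℕ → Finset (Fin M)} {t : ℕ → ℝ} {γ : ℝ → Euc M} {l : ℝ} {V : ℕ → Euc M}

lemma t_lt (h : IsCrossing X k A B t γ l V) {i j : ℕ} (hij : i < j) (hj : j ≤ k + 1) :
    t i < t j :=
  (h.t_lt_succ i (by omega)).trans_le (le_of_le_succ (fun i hi => (h.t_lt_succ i hi).le) hij hj)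

lemma t_pos (h : IsCrossing X k A B t γ l V) {j : ℕ} (hj : 1 ≤ j) (hjk : j ≤ k + 1) : 0 < t j :=
  h.t_zero ▸ h.t_lt hj hjk

lemma t_lt_one (h : IsCrossing X k A B t γ l V) {j : ℕ} (hj : j ≤ k) : t j < 1 :=
  h.t_last ▸ h.t_lt (Nat.lt_succ_of_le hj) le_rfl

lemma left_mem (h : IsCrossing X k A B t γ l V) {i : ℕ} (hi : i ≤ k) :
    t i ∈ Set.Icc (t i) (t (i + 1)) := ⟨le_rfl, (h.t_lt_succ i hi).le⟩

lemma right_mem (h : IsCrossing X k A B t γ l V) {i : ℕ} (hi : i ≤ k) :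
    t (i + 1) ∈ Set.Icc (t i) (t (i + 1)) := ⟨(h.t_lt_succ i hi).le, le_rfl⟩

lemma sub_eq_of_const (h : IsCrossing X k A B t γ l V) {a b : ℕ} (hab : a ≤ b)
    (hb : b ≤ k + 1) {e : Fin M} {c : ℝ} (hc : ∀ i, a ≤ i → i < b → V i e = c) :
    γ (t b) e - γ (t a) e = (t b - t a) * c := by
  induction b, hab using Nat.le_induction with
  | base => simp
  | succ n hn ih =>
    have h1 := ih (by omega) fun i hi hin => hc i hi (by omega)
    have h2 := h.sub_eq n (by omega) _ (h.left_mem (by omega)) _ (h.right_mem (by omega)) e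
    rw [hc n hn (by omega)] at h2
    linarith

lemma velocity_const (h : IsCrossing X k A B t γ l V) {a b : ℕ} (hb : b ≤ k + 1) {e : Fin M}
    (he : ∀ i, a ≤ i → i < b → e ∈ stage k A B i) {i : ℕ} (hai : a ≤ i) (hib : i < b) :
    V i e = V a e := by
  induction i, hai using Nat.le_induction with
  | base => rfl
  | succ n hn ih =>
    rw [← ih (by omega)]
    exact (h.velocity_eq n (by omega) e (he n hn (by omega)) (he (n + 1) (by omega) hib)).symm

lemma apply_eq_zero_A (h : IsCrossing X k A B t γ l V) {j : ℕ} (hj : 1 ≤ j) (hjk : j ≤ k)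
    {e : Fin M} (he : e ∈ A j) : γ (t j) e = 0 :=
  (h.mem_closedOrthant j hjk _ (h.left_mem hjk)).2 e fun hs =>
    lt_irrefl _ ((h.mem_stage_A hjk hj hjk he).1 hs)

lemma apply_eq_zero_B (h : IsCrossing X k A B t γ l V) {j : ℕ} (hj : 1 ≤ j) (hjk : j ≤ k)
    {e : Fin M} (he : e ∈ B j) : γ (t j) e = 0 := by
  obtain ⟨i, rfl⟩ := Nat.exists_eq_add_of_le' hj
  refine (h.mem_closedOrthant i (by omega) _ (h.right_mem (by omega))).2 e fun hs => ?_
  exact absurd ((h.mem_stage_B (by omega) hj hjk he).1 hs) (by omega)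

/-- An axis of `A (i + 1)` belongs to stages `0, …, i`, so its velocity is constant up to the time
`t (i + 1)` at which its coordinate vanishes. -/
lemma start_A (h : IsCrossing X k A B t γ l V) {i : ℕ} (hi : i < k) {e : Fin M}
    (he : e ∈ A (i + 1)) : γ 0 e = -(t (i + 1) * V i e) ∧ 0 < γ 0 e := by
  have hmem : ∀ n, 0 ≤ n → n < i + 1 → e ∈ stage k A B n := fun n _ hn =>
    (h.mem_stage_A (by omega) (by omega) hi he).2 hn
  have hc := fun n h0 hn => h.velocity_const (b := i + 1) (by omega) hmem (i := n) h0 hn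
  have h1 := h.sub_eq_of_const (Nat.zero_le (i + 1)) (by omega) hc
  rw [h.apply_eq_zero_A (by omega) hi he, h.t_zero] at h1
  have h2 : γ 0 e = -(t (i + 1) * V i e) := by
    rw [hc i (Nat.zero_le i) (by omega)]
    linarith
  refine ⟨h2, ?_⟩
  have h3 := h.t_lt_succ i hi.le
  -- The coordinate is positive in the middle of the leg and zero at its end, so its velocity is
  -- negative.
  have hs : (t i + t (i + 1)) / 2 ∈ Set.Ioo (t i) (t (i + 1)) := ⟨by linarith, by linarith⟩
  have h4 := (h.mem_orthant i hi.le _ hs).1 e (hmem i (Nat.zero_le i) (by omega))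
  have h5 := h.sub_eq i hi.le _ (Set.Ioo_subset_Icc_self hs) _ (h.right_mem hi.le) e
  rw [h.apply_eq_zero_A (by omega) hi he] at h5
  have h6 : V i e < 0 := by
    by_contra! hV
    have := mul_nonneg (sub_nonneg.2 hs.2.le) hV
    linarith
  have h7 := h.t_pos (show 1 ≤ i + 1 by omega) (by omega)
  rw [h2]
  have := mul_neg_of_pos_of_neg h7 h6
  linarith

lemma end_B (h : IsCrossing X k A B t γ l V) {j : ℕ} (hj : 1 ≤ j) (hjk : j ≤ k) {e : Fin M}
    (he : e ∈ B j) : γ 1 e = (1 - t j) * V j e ∧ 0 < γ 1 e := by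
  have hmem : ∀ n, j ≤ n → n < k + 1 → e ∈ stage k A B n := fun n hn hnk =>
    (h.mem_stage_B (by omega) hj hjk he).2 hn
  have hc := fun n h0 hn => h.velocity_const (b := k + 1) le_rfl hmem (i := n) h0 hn
  have h1 := h.sub_eq_of_const (show j ≤ k + 1 by omega) le_rfl hc
  rw [h.apply_eq_zero_B hj hjk he, h.t_last, sub_zero] at h1
  refine ⟨h1, ?_⟩
  have h3 := h.t_lt_succ j hjk
  have hs : (t j + t (j + 1)) / 2 ∈ Set.Ioo (t j) (t (j + 1)) := ⟨by linarith, by linarith⟩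
  have h4 := (h.mem_orthant j hjk _ hs).1 e (hmem j le_rfl (by omega))
  have h5 := h.sub_eq j hjk _ (h.left_mem hjk) _ (Set.Ioo_subset_Icc_self hs) e
  rw [h.apply_eq_zero_B hj hjk he, sub_zero] at h5
  have h6 : 0 < V j e := by
    by_contra! hV
    have := mul_nonpos_of_nonneg_of_nonpos (sub_nonneg.2 hs.1.le) hV
    linarith
  rw [h1]
  exact mul_pos (sub_pos.2 (h.t_lt_one hjk)) h6

lemma velocity_eq_zero (h : IsCrossing X k A B t γ l V) {i : ℕ} (hi : i ≤ k) {e : Fin M}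
    (he : e ∉ stage k A B i) : V i e = 0 := by
  have h1 := h.sub_eq i hi _ (h.left_mem hi) _ (h.right_mem hi) e
  rw [(h.mem_closedOrthant i hi _ (h.left_mem hi)).2 e he,
    (h.mem_closedOrthant i hi _ (h.right_mem hi)).2 e he, sub_zero, zero_eq_mul] at h1
  exact h1.resolve_left (sub_ne_zero.2 (h.t_lt_succ i hi).ne')

lemma sq_eq_sum_stage (h : IsCrossing X k A B t γ l V) {i : ℕ} (hi : i ≤ k) :
    l ^ 2 = ∑ e ∈ stage k A B i, V i e ^ 2 := by
  rw [← h.norm_velocity i hi, EuclideanSpace.real_norm_sq_eq]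
  refine (Finset.sum_subset (Finset.subset_univ _) fun e _ he => ?_).symm
  rw [h.velocity_eq_zero hi he, zero_pow two_ne_zero]

end IsCrossing

/-! ### Adjacent stages and the two-step shortcut -/

namespace DisjointAxes

variable {k : ℕ} {A B : ℕ → Finset (Fin M)}

lemma stage_eq_left (h : DisjointAxes k A B) {i : ℕ} (hi : i < k) :
    stage k A B i = stage k A B i ∩ stage k A B (i + 1) ∪ A (i + 1) := by
  ext e
  rw [Finset.mem_union, Finset.mem_inter]
  refine ⟨fun he => ?_, ?_⟩
  · rcases mem_stage.1 he with h0 | ⟨j, hj, hji, hej⟩ | ⟨j, hj, hjk, hej⟩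
    · exact Or.inl ⟨he, mem_stage.2 (Or.inl h0)⟩
    · exact Or.inl ⟨he, (h.mem_stage_B hi hj (by omega) hej).2 (by omega)⟩
    · rcases hj.eq_or_lt with rfl | hj
      · exact Or.inr hej
      · exact Or.inl ⟨he, (h.mem_stage_A hi (by omega) hjk hej).2 hj⟩
  · rintro (he | he)
    · exact he.1
    · exact (h.mem_stage_A hi.le (by omega) hi he).2 (by omega)

lemma stage_eq_right (h : DisjointAxes k A B) {i : ℕ} (hi : i < k) :
    stage k A B (i + 1) = stage k A B i ∩ stage k A B (i + 1) ∪ B (i + 1) := by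
  ext e
  rw [Finset.mem_union, Finset.mem_inter]
  refine ⟨fun he => ?_, ?_⟩
  · rcases mem_stage.1 he with h0 | ⟨j, hj, hji, hej⟩ | ⟨j, hj, hjk, hej⟩
    · exact Or.inl ⟨mem_stage.2 (Or.inl h0), he⟩
    · rcases hji.eq_or_lt with rfl | hj'
      · exact Or.inr hej
      · exact Or.inl ⟨(h.mem_stage_B hi.le hj (by omega) hej).2 (by omega), he⟩
    · exact Or.inl ⟨(h.mem_stage_A hi.le (by omega) hjk hej).2 (by omega), he⟩
  · rintro (he | he)
    · exact he.2
    · exact (h.mem_stage_B hi (by omega) hi he).2 le_rfl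

lemma disjoint_inter_A (h : DisjointAxes k A B) {i : ℕ} (hi : i < k) :
    Disjoint (stage k A B i ∩ stage k A B (i + 1)) (A (i + 1)) :=
  Finset.disjoint_left.2 fun _ he he' => lt_irrefl _
    ((h.mem_stage_A hi (by omega) hi he').1 (Finset.mem_inter.1 he).2)

lemma disjoint_inter_B (h : DisjointAxes k A B) {i : ℕ} (hi : i < k) :
    Disjoint (stage k A B i ∩ stage k A B (i + 1)) (B (i + 1)) :=
  Finset.disjoint_left.2 fun _ he he' => absurd
    ((h.mem_stage_B hi.le (by omega) hi he').1 (Finset.mem_inter.1 he).1) (by omega)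

lemma inter_subset_refinedStage (h : DisjointAxes k A B) (h0 : B 0 = A 0) {i : ℕ} (hi : i < k)
    (D C : Finset (Fin M)) :
    stage k A B i ∩ stage k A B (i + 1) ⊆ refinedStage k A B (i + 1) D C := by
  intro e he
  obtain ⟨he, he'⟩ := Finset.mem_inter.1 he
  rw [mem_refinedStage]
  rcases mem_stage.1 he with h1 | ⟨j, hj, hji, hej⟩ | ⟨j, hj, hjk, hej⟩
  · exact Or.inl ⟨0, by omega, h0 ▸ h1⟩
  · exact Or.inl ⟨j, by omega, hej⟩
  · exact Or.inr (Or.inr (Or.inr ⟨j, (h.mem_stage_A hi (by omega) hjk hej).1 he', hjk, hej⟩))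

end DisjointAxes

/-- A path that exchanges first `C₁` for `D₁` and then `C₂` for `D₂`. -/
lemma intrinsicDist_sq_le_of_two_steps (hX : IsOrthantSpace m X)
    {S C₁ C₂ D₁ D₂ : Finset (Fin M)} {p q : Euc M}
    (hSC₁ : Disjoint S C₁) (hSC₂ : Disjoint S C₂) (hSD₁ : Disjoint S D₁) (hSD₂ : Disjoint S D₂)
    (hC : Disjoint C₁ C₂) (hD : Disjoint D₁ D₂) (hCD₁₁ : Disjoint C₁ D₁) (hCD₁₂ : Disjoint C₁ D₂)
    (hCD₂₁ : Disjoint C₂ D₁) (hCD₂₂ : Disjoint C₂ D₂)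
    (hp : p ∈ closedOrthant (S ∪ (C₁ ∪ C₂))) (hq : q ∈ closedOrthant (S ∪ (D₁ ∪ D₂)))
    (h₀ : orthant (S ∪ (C₁ ∪ C₂)) ⊆ X) (h₁ : orthant (S ∪ (D₁ ∪ C₂)) ⊆ X)
    (h₂ : orthant (S ∪ (D₁ ∪ D₂)) ⊆ X)
    (hlt : ‖proj C₁ p‖ * ‖proj D₂ q‖ < ‖proj C₂ p‖ * ‖proj D₁ q‖) :
    intrinsicDist X p q ^ 2 ≤ ‖proj S (q - p)‖ ^ 2 +
      ((‖proj C₁ p‖ + ‖proj D₁ q‖) ^ 2 + (‖proj C₂ p‖ + ‖proj D₂ q‖) ^ 2) := by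
  have hc₁ := norm_nonneg (proj C₁ p)
  have hc₂ := norm_nonneg (proj C₂ p)
  have hd₁ := norm_nonneg (proj D₁ q)
  have hd₂ := norm_nonneg (proj D₂ q)
  have hpos : 0 < ‖proj C₂ p‖ * ‖proj D₁ q‖ := (mul_nonneg hc₁ hd₂).trans_lt hlt
  -- Both denominators in `t` are now positive, although `C₁` or `D₂` may be empty; the order of the
  -- two times is `hlt` itself.
  have hc₂' : 0 < ‖proj C₂ p‖ := lt_of_le_of_ne hc₂ fun h => by simp [← h] at hpos
  have hd₁' : 0 < ‖proj D₁ q‖ := lt_of_le_of_ne hd₁ fun h => by simp [← h] at hpos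
  let A : ℕ → Finset (Fin M) := fun n => if n = 0 then S else if n = 1 then C₁ else C₂
  let B : ℕ → Finset (Fin M) := fun n => if n = 0 then S else if n = 1 then D₁ else D₂
  let t : ℕ → ℝ := fun n => if n = 0 then 0 else
    if n = 1 then ‖proj C₁ p‖ / (‖proj C₁ p‖ + ‖proj D₁ q‖) else
    if n = 2 then ‖proj C₂ p‖ / (‖proj C₂ p‖ + ‖proj D₂ q‖) else 1
  have hs0 : stage 2 A B 0 = S ∪ (C₁ ∪ C₂) := by
    simp [stage, A, show Finset.Icc 1 2 = {1, 2} from rfl]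
  have hs1 : stage 2 A B 1 = S ∪ (D₁ ∪ C₂) := by
    simp [stage, A, B]
  have hs2 : stage 2 A B 2 = S ∪ (D₁ ∪ D₂) := by
    simp [stage, A, B, show Finset.Icc 1 2 = {1, 2} from rfl]
  have hL : IsLadder 2 A B t p q :=
    { disjAA := by
        intro i hi j hj hij
        interval_cases i <;> interval_cases j <;> first | exact absurd rfl hij | skip
        all_goals simp [A, hSC₁, hSC₂, hC, hSC₁.symm, hSC₂.symm, hC.symm]
      disjBB := by
        intro i j hi hi' hj hj' hij
        interval_cases i <;> interval_cases j <;> first | exact absurd rfl hij | skip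
        all_goals simp [B, hD, hD.symm]
      disjAB := by
        intro i hi j hj hj'
        interval_cases i <;> interval_cases j <;>
          simp [A, B, hSD₁, hSD₂, hCD₁₁, hCD₁₂, hCD₂₁, hCD₂₂]
      t_zero := by simp [t]
      t_last := by simp [t]
      t_le_succ := by
        intro i hi
        interval_cases i
        · simp only [t, if_true, zero_add, one_ne_zero, if_false]
          positivity
        · simp only [t, one_ne_zero, if_false, if_true, Nat.reduceAdd, OfNat.ofNat_ne_zero,
            OfNat.ofNat_ne_one]
          rw [div_le_div_iff₀ (by positivity) (by positivity)]
          linarith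
        · simp only [t, if_false, if_true, Nat.reduceAdd, OfNat.ofNat_ne_zero,
            OfNat.ofNat_ne_one, Nat.reduceEqDiff]
          exact (div_le_one (by positivity)).2 (by linarith)
      p_nonneg := hp.1
      q_nonneg := hq.1
      p_zero := hs0 ▸ hp.2
      q_zero := hs2 ▸ hq.2
      balance := by
        intro j hj hj'
        interval_cases j
        · simp only [t, A, B, one_ne_zero, if_false, if_true]
          rw [div_mul_cancel₀ _ (by positivity)]
        · simp only [t, A, B, if_false, if_true, OfNat.ofNat_ne_zero, OfNat.ofNat_ne_one]
          rw [div_mul_cancel₀ _ (by positivity)] }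
  have h1 := hL.intrinsicDist_le hX fun i hi => by
    interval_cases i
    · rwa [hs0]
    · rwa [hs1]
    · rwa [hs2]
  have hpX : p ∈ X := hX.closedOrthant_subset h₀ hp
  have hqX : q ∈ X := hX.closedOrthant_subset h₂ hq
  have h2 := pow_le_pow_left₀ (dist_nonneg.trans (hX.dist_le_intrinsicDist hpX hqX)) h1 2
  rw [Real.sq_sqrt (ladderSq_nonneg _ _ _ _ _)] at h2
  simpa [ladderSq, A, B, show Finset.Icc 1 2 = {1, 2} from rfl] using h2

/-! ### Conditions (i) and (ii) from a crossing geodesic -/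

namespace IsCrossing

variable {k : ℕ} {A B : ℕ → Finset (Fin M)} {t : ℕ → ℝ} {γ : ℝ → Euc M} {l : ℝ} {V : ℕ → Euc M}

lemma norm_velocity_sq (h : IsCrossing X k A B t γ l V) {i : ℕ} (hi : i < k) :
    l ^ 2 = ‖proj (stage k A B i ∩ stage k A B (i + 1)) (V i)‖ ^ 2 +
      ‖proj (A (i + 1)) (V i)‖ ^ 2 := by
  rw [← norm_proj_union_sq (h.disjoint_inter_A hi), ← h.stage_eq_left hi, norm_proj_sq,
    h.sq_eq_sum_stage hi.le]

lemma norm_velocity_sq' (h : IsCrossing X k A B t γ l V) {i : ℕ} (hi : i < k) :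
    l ^ 2 = ‖proj (stage k A B i ∩ stage k A B (i + 1)) (V i)‖ ^ 2 +
      ‖proj (B (i + 1)) (V (i + 1))‖ ^ 2 := by
  have h1 : ‖proj (stage k A B i ∩ stage k A B (i + 1)) (V i)‖
      = ‖proj (stage k A B i ∩ stage k A B (i + 1)) (V (i + 1))‖ := by
    rw [norm_proj_congr_mul (c := 1) fun e he => ?_, abs_one, one_mul]
    rw [one_mul, h.velocity_eq i hi e (Finset.mem_inter.1 he).1 (Finset.mem_inter.1 he).2]
  rw [h1, ← norm_proj_union_sq (h.disjoint_inter_B hi), ← h.stage_eq_right hi, norm_proj_sq,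
    h.sq_eq_sum_stage hi]

/-- Adjacent legs have the same speed and the same velocity on their common axes, so the remaining
parts have equal norm. -/
lemma norm_velocity_A_eq_B (h : IsCrossing X k A B t γ l V) {i : ℕ} (hi : i < k) :
    ‖proj (A (i + 1)) (V i)‖ = ‖proj (B (i + 1)) (V (i + 1))‖ := by
  refine (sq_eq_sq₀ (norm_nonneg _) (norm_nonneg _)).1 ?_
  linarith [h.norm_velocity_sq hi, h.norm_velocity_sq' hi]

lemma norm_start (h : IsCrossing X k A B t γ l V) {i : ℕ} (hi : i < k) :
    ‖proj (A (i + 1)) (γ 0)‖ = t (i + 1) * ‖proj (A (i + 1)) (V i)‖ := by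
  rw [norm_proj_congr_mul (c := -t (i + 1)) (y := V i), abs_neg,
    abs_of_pos (h.t_pos (by omega) (by omega))]
  intro e he
  rw [(h.start_A hi he).1, neg_mul]

lemma norm_end (h : IsCrossing X k A B t γ l V) {i : ℕ} (hi : i < k) :
    ‖proj (B (i + 1)) (γ 1)‖ = (1 - t (i + 1)) * ‖proj (A (i + 1)) (V i)‖ := by
  rw [norm_proj_congr_mul (c := 1 - t (i + 1)) (y := V (i + 1)), h.norm_velocity_A_eq_B hi,
    abs_of_pos (sub_pos.2 (h.t_lt_one (by omega)))]
  exact fun e he => (h.end_B (by omega) hi he).1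

lemma biUnion_A (h : IsCrossing X k A B t γ l V) :
    (Finset.Icc 1 k).biUnion A = posAxes (γ 0) \ A 0 := by
  ext e
  rw [Finset.mem_biUnion, Finset.mem_sdiff, mem_posAxes]
  constructor
  · rintro ⟨j, hj, hej⟩
    rw [Finset.mem_Icc] at hj
    obtain ⟨i, rfl⟩ := Nat.exists_eq_add_of_le' hj.1
    exact ⟨(h.start_A (by omega) hej).2,
      h.notMem_zero hj.1 hj.2 (Finset.mem_union_left _ hej)⟩
  · rintro ⟨hpos, h0⟩
    have h1 : e ∈ stage k A B 0 := by
      by_contra he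
      have h2 := (h.mem_closedOrthant 0 (Nat.zero_le k) _ (h.left_mem (Nat.zero_le k))).2 e he
      rw [h.t_zero] at h2
      exact hpos.ne' h2
    rcases mem_stage.1 h1 with h2 | ⟨j, hj, hj0, -⟩ | ⟨j, hj, hjk, hej⟩
    · exact absurd h2 h0
    · omega
    · exact ⟨j, Finset.mem_Icc.2 ⟨hj, hjk⟩, hej⟩

lemma biUnion_B (h : IsCrossing X k A B t γ l V) :
    (Finset.Icc 1 k).biUnion B = posAxes (γ 1) \ A 0 := by
  ext e
  rw [Finset.mem_biUnion, Finset.mem_sdiff, mem_posAxes]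
  constructor
  · rintro ⟨j, hj, hej⟩
    rw [Finset.mem_Icc] at hj
    exact ⟨(h.end_B hj.1 hj.2 hej).2, h.notMem_zero hj.1 hj.2 (Finset.mem_union_right _ hej)⟩
  · rintro ⟨hpos, h0⟩
    have h1 : e ∈ stage k A B k := by
      by_contra he
      have h2 := (h.mem_closedOrthant k le_rfl _ (h.right_mem le_rfl)).2 e he
      rw [h.t_last] at h2
      exact hpos.ne' h2
    rcases mem_stage.1 h1 with h2 | ⟨j, hj, hjk, hej⟩ | ⟨j, hj, hjk, -⟩
    · exact absurd h2 h0
    · exact ⟨j, Finset.mem_Icc.2 ⟨hj, hjk⟩, hej⟩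
    · omega

/-- The ratio for block `j` is `t j / (1 - t j)`, since both norms carry the same velocity factor,
and the times strictly increase. -/
lemma ratio_lt (h : IsCrossing X k A B t γ l V)
    (hne : ∀ i, 1 ≤ i → i ≤ k → (A i).Nonempty) {i : ℕ} (hi : i + 1 < k) :
    ratio (γ 0) (γ 1) (A (i + 1)) (B (i + 1)) <
      ratio (γ 0) (γ 1) (A (i + 1 + 1)) (B (i + 1 + 1)) := by
  have hA : ∀ j < k, ∀ e ∈ A (j + 1), γ 0 e ≠ 0 := fun j hj e he => (h.start_A hj he).2.ne'
  have hB : ∀ j < k, ∀ e ∈ B (j + 1), γ 1 e ≠ 0 := fun j hj e he =>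
    (h.end_B (by omega) hj he).2.ne'
  have hpos : ∀ j < k, 0 < ‖proj (A (j + 1)) (V j)‖ := by
    intro j hj
    have h1 := norm_proj_pos (hA j hj) (hne (j + 1) (by omega) hj)
    rw [h.norm_start hj] at h1
    exact pos_of_mul_pos_right h1 (h.t_pos (by omega) (by omega)).le
  rw [ratio_lt_ratio_iff (hA i (by omega)) (hA (i + 1) hi) (hB i (by omega)) (hB (i + 1) hi)
    ((hne (i + 1) (by omega) (by omega)).mono Finset.subset_union_left)
    ((hne (i + 1 + 1) (by omega) (by omega)).mono Finset.subset_union_left),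
    h.norm_start (i := i) (by omega), h.norm_start hi, h.norm_end (i := i) (by omega),
    h.norm_end hi]
  have h1 := mul_pos (hpos i (by omega)) (hpos (i + 1) hi)
  have h2 := h.t_lt_succ (i + 1) (by omega)
  have h3 := mul_lt_mul_of_pos_left h2 h1
  linarith

/-- If the inequality failed, swapping `C₁` for `D₁` before `C₂` for `D₂` near the crossing would
give a strictly shorter path than the geodesic, which exchanges everything at once. -/
lemma ratio_le (h : IsCrossing X k A B t γ l V) (hX : IsOrthantSpace m X) (h0 : B 0 = A 0)
    (hO : ∀ i ≤ k, orthant (stage k A B i) ⊆ X) {i : ℕ} (hi : i < k)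
    {C₁ C₂ D₁ D₂ : Finset (Fin M)} (hC : Disjoint C₁ C₂) (hCA : C₁ ∪ C₂ = A (i + 1))
    (hD : Disjoint D₁ D₂) (hDB : D₁ ∪ D₂ = B (i + 1)) (h₁ : (C₁ ∪ D₁).Nonempty)
    (h₂ : (C₂ ∪ D₂).Nonempty) (hor : orthant (refinedStage k A B (i + 1) D₁ C₂) ⊆ X) :
    ratio (γ 0) (γ 1) C₂ D₂ ≤ ratio (γ 0) (γ 1) C₁ D₁ := by
  have hC₁ : C₁ ⊆ A (i + 1) := hCA ▸ Finset.subset_union_left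
  have hC₂ : C₂ ⊆ A (i + 1) := hCA ▸ Finset.subset_union_right
  have hD₁ : D₁ ⊆ B (i + 1) := hDB ▸ Finset.subset_union_left
  have hD₂ : D₂ ⊆ B (i + 1) := hDB ▸ Finset.subset_union_right
  have hA : ∀ e ∈ A (i + 1), γ 0 e ≠ 0 := fun e he => (h.start_A hi he).2.ne'
  have hB : ∀ e ∈ B (i + 1), γ 1 e ≠ 0 := fun e he => (h.end_B (by omega) hi he).2.ne'
  by_contra! hlt
  rw [ratio_lt_ratio_iff (fun e he => hA e (hC₁ he)) (fun e he => hA e (hC₂ he))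
    (fun e he => hB e (hD₁ he)) (fun e he => hB e (hD₂ he)) h₁ h₂] at hlt
  have ht1 := h.t_lt_succ i hi.le
  have ht2 := h.t_lt_succ (i + 1) hi
  have htpos := h.t_pos (show 1 ≤ i + 1 by omega) (by omega)
  have htone := h.t_lt_one (show i + 1 ≤ k from hi)
  obtain ⟨ε, hε, hε1, hε2⟩ : ∃ ε, 0 < ε ∧ ε ≤ t (i + 1) - t i ∧ ε ≤ t (i + 1 + 1) - t (i + 1) :=
    ⟨min (t (i + 1) - t i) (t (i + 1 + 1) - t (i + 1)), lt_min (by linarith) (by linarith),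
      min_le_left _ _, min_le_right _ _⟩
  have hp : t (i + 1) - ε ∈ Set.Icc (t i) (t (i + 1)) := ⟨by linarith, by linarith⟩
  have hq : t (i + 1) + ε ∈ Set.Icc (t (i + 1)) (t (i + 1 + 1)) := ⟨by linarith, by linarith⟩
  set p := γ (t (i + 1) - ε) with hp_def
  set q := γ (t (i + 1) + ε) with hq_def
  set S := stage k A B i ∩ stage k A B (i + 1) with hS
  have hpV : ∀ e, γ (t (i + 1)) e - p e = ε * V i e := fun e => by
    rw [h.sub_eq i hi.le _ hp _ (h.right_mem hi.le), sub_sub_cancel]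
  have hqV : ∀ e, q e - γ (t (i + 1)) e = ε * V (i + 1) e := fun e => by
    rw [h.sub_eq (i + 1) hi _ (h.left_mem hi) _ hq, add_sub_cancel_left]
  have hpA : ∀ e ∈ A (i + 1), p e = -ε * V i e := fun e he => by
    have := hpV e
    rw [h.apply_eq_zero_A (by omega) hi he] at this
    linarith
  have hqB : ∀ e ∈ B (i + 1), q e = ε * V (i + 1) e := fun e he => by
    have := hqV e
    rw [h.apply_eq_zero_B (by omega) hi he] at this
    linarith
  -- On the exchanged axes `p` and `q` are positive multiples of the endpoints, so the violated
  -- inequality carries over to them.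
  have hpC : ∀ C ⊆ A (i + 1), ‖proj C p‖ = ε / t (i + 1) * ‖proj C (γ 0)‖ := fun C hCA => by
    rw [norm_proj_congr_mul (c := ε / t (i + 1)) (y := γ 0), abs_of_pos (by positivity)]
    intro e he
    rw [hpA e (hCA he), (h.start_A hi (hCA he)).1]
    field_simp
  have hqD : ∀ D ⊆ B (i + 1), ‖proj D q‖ = ε / (1 - t (i + 1)) * ‖proj D (γ 1)‖ := fun D hDB => by
    have h1 : 0 < 1 - t (i + 1) := by linarith
    rw [norm_proj_congr_mul (c := ε / (1 - t (i + 1))) (y := γ 1), abs_of_pos (by positivity)]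
    intro e he
    rw [hqB e (hDB he), (h.end_B (by omega) hi (hDB he)).1]
    field_simp
  have hlt' : ‖proj C₁ p‖ * ‖proj D₂ q‖ < ‖proj C₂ p‖ * ‖proj D₁ q‖ := by
    rw [hpC C₁ hC₁, hpC C₂ hC₂, hqD D₁ hD₁, hqD D₂ hD₂]
    have h1 : 0 < ε / t (i + 1) * (ε / (1 - t (i + 1))) :=
      mul_pos (div_pos hε htpos) (div_pos hε (by linarith))
    have h2 := mul_lt_mul_of_pos_left hlt h1
    linarith
  have hst1 : stage k A B i = S ∪ (C₁ ∪ C₂) := hCA ▸ h.stage_eq_left hi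
  have hst2 : stage k A B (i + 1) = S ∪ (D₁ ∪ D₂) := hDB ▸ h.stage_eq_right hi
  have hSA := h.disjoint_inter_A hi
  have hSB := h.disjoint_inter_B hi
  have hAB := h.disjAB (i + 1) hi (i + 1) (by omega) hi
  have key := intrinsicDist_sq_le_of_two_steps hX (p := p) (q := q)
    (hSA.mono_right hC₁) (hSA.mono_right hC₂) (hSB.mono_right hD₁) (hSB.mono_right hD₂) hC hD
    (hAB.mono hC₁ hD₁) (hAB.mono hC₁ hD₂) (hAB.mono hC₂ hD₁) (hAB.mono hC₂ hD₂)
    (hst1 ▸ h.mem_closedOrthant i hi.le _ hp) (hst2 ▸ h.mem_closedOrthant (i + 1) hi _ hq)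
    (hst1 ▸ hO i hi.le)
    (hX.orthant_subset_of_subset hor (Finset.union_subset
      (h.inter_subset_refinedStage h0 hi D₁ C₂) fun e he => mem_refinedStage.2
        (Or.inr ((Finset.mem_union.1 he).imp_right Or.inl))))
    (hst2 ▸ hO (i + 1) hi) hlt'
  have ht0 : 0 ≤ t i := h.t_zero ▸ le_of_le_succ (fun i hi => (h.t_lt_succ i hi).le)
    (Nat.zero_le i) (by omega)
  have ht3 : t (i + 1 + 1) ≤ 1 := h.t_last ▸ le_of_le_succ (fun i hi => (h.t_lt_succ i hi).le)
    (by omega) le_rfl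
  have hd : intrinsicDist X p q = 2 * ε * l := by
    rw [hp_def, hq_def, h.dist_eq _ ⟨by linarith, by linarith⟩ _ ⟨by linarith, by linarith⟩,
      show t (i + 1) - ε - (t (i + 1) + ε) = -(2 * ε) by ring, abs_neg, abs_of_pos (by positivity)]
  have hSn : ‖proj S (q - p)‖ = 2 * ε * ‖proj S (V i)‖ := by
    rw [norm_proj_congr_mul (c := 2 * ε) (y := V i), abs_of_pos (by positivity)]
    intro e he
    have h1 := h.velocity_eq i hi e (Finset.mem_inter.1 he).1 (Finset.mem_inter.1 he).2
    have h2 := hpV e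
    have h3 := hqV e
    rw [← h1] at h3
    rw [PiLp.sub_apply]
    linarith
  -- The two blocks have equal norm at `p` and `q`, so the exchange part of the squared geodesic
  -- length is `2 (c₁² + c₂² + d₁² + d₂²)`. Minimality against `(c₁ + d₁)² + (c₂ + d₂)²` forces `c₁
  -- = d₁` and `c₂ = d₂`, contradicting `c₁ d₂ < c₂ d₁`.
  have hAn : ‖proj C₁ p‖ ^ 2 + ‖proj C₂ p‖ ^ 2 = (ε * ‖proj (A (i + 1)) (V i)‖) ^ 2 := by
    rw [← norm_proj_union_sq hC, hCA, norm_proj_congr_mul hpA, abs_neg, abs_of_pos hε]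
  have hBn : ‖proj D₁ q‖ ^ 2 + ‖proj D₂ q‖ ^ 2 = (ε * ‖proj (A (i + 1)) (V i)‖) ^ 2 := by
    rw [← norm_proj_union_sq hD, hDB, norm_proj_congr_mul hqB, abs_of_pos hε,
      h.norm_velocity_A_eq_B hi]
  have hl := h.norm_velocity_sq hi
  rw [hd, hSn, mul_pow, hl] at key
  have h4 : (‖proj C₁ p‖ - ‖proj D₁ q‖) ^ 2 + (‖proj C₂ p‖ - ‖proj D₂ q‖) ^ 2 ≤ 0 := by
    linarith
  have h5 : ‖proj C₁ p‖ = ‖proj D₁ q‖ := by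
    have := sq_nonneg (‖proj C₂ p‖ - ‖proj D₂ q‖)
    have := (pow_eq_zero_iff two_ne_zero).1 (le_antisymm (by linarith) (sq_nonneg
      (‖proj C₁ p‖ - ‖proj D₁ q‖)))
    linarith
  have h6 : ‖proj C₂ p‖ = ‖proj D₂ q‖ := by
    have := sq_nonneg (‖proj C₁ p‖ - ‖proj D₁ q‖)
    have := (pow_eq_zero_iff two_ne_zero).1 (le_antisymm (by linarith) (sq_nonneg
      (‖proj C₂ p‖ - ‖proj D₂ q‖)))
    linarith
  rw [h5, h6] at hlt'
  linarith

end IsCrossing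

end Orthant

theorem mainTheorem2 {M m : ℕ} (X : Set (Orthant.Euc M)) (hX : Orthant.IsOrthantSpace m X)
    (x₁ x₂ : Orthant.Euc M) (hx₁ : x₁ ∈ X) (hx₂ : x₂ ∈ X)
    (k : ℕ) (hk : 0 < k) (A B : ℕ → Finset (Fin M))
    (hA₀ : A 0 = Orthant.commonAxes X x₁ x₂) (hB₀ : B 0 = Orthant.commonAxes X x₁ x₂)
    (hO : ∀ i ≤ k, Orthant.orthant (Orthant.stage k A B i) ⊆ X)
    (hne : ∀ i, 1 ≤ i → i ≤ k → (A i).Nonempty ∧ (B i).Nonempty)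
    (hAA : ∀ i ≤ k, ∀ j ≤ k, i ≠ j → Disjoint (A i) (A j))
    (hBB : ∀ i ≤ k, ∀ j ≤ k, i ≠ j → Disjoint (B i) (B j))
    (hAB : ∀ i ≤ k, ∀ j ≤ k, (i ≠ 0 ∨ j ≠ 0) → Disjoint (A i) (B j)) :
    Orthant.IsSupport X x₁ x₂ k A B ↔
      ((Finset.Icc 1 k).biUnion A = Orthant.posAxes x₁ \ A 0 ∧
        (Finset.Icc 1 k).biUnion B = Orthant.posAxes x₂ \ B 0) ∧
      (∀ i, 0 < i → i < k →
        Orthant.ratio x₁ x₂ (A i) (B i) < Orthant.ratio x₁ x₂ (A (i + 1)) (B (i + 1))) ∧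
      (∀ i, 0 < i → i ≤ k → ∀ C₁ C₂ D₁ D₂ : Finset (Fin M),
        Disjoint C₁ C₂ → C₁ ∪ C₂ = A i → Disjoint D₁ D₂ → D₁ ∪ D₂ = B i →
        (C₁ ∪ D₁).Nonempty → (C₂ ∪ D₂).Nonempty →
        Orthant.orthant (Orthant.refinedStage k A B i D₁ C₂) ⊆ X →
        Orthant.ratio x₁ x₂ C₂ D₂ ≤ Orthant.ratio x₁ x₂ C₁ D₁) := by
  constructor
  · rintro ⟨γ, hγ, hc⟩
    have hd : Orthant.DisjointAxes k A B :=
      ⟨hAA, fun i j _ hi _ hj hij => hBB i hi j hj hij,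
        fun i hi j hj hjk => hAB i hi j hjk (Or.inr (by omega))⟩
    obtain ⟨t, V, h⟩ := hγ.exists_isCrossing hX hd hO hc
    obtain ⟨rfl, rfl, -⟩ := hγ
    have h0 : B 0 = A 0 := hB₀.trans hA₀.symm
    refine ⟨⟨h.biUnion_A, h0 ▸ h.biUnion_B⟩, fun i hi hik => ?_,
      fun i hi hik C₁ C₂ D₁ D₂ hC hCA hD hDB h₁ h₂ hor => ?_⟩
    · obtain ⟨i, rfl⟩ := Nat.exists_eq_add_of_le' hi
      exact h.ratio_lt (fun i hi hik => (hne i hi hik).1) hik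
    · obtain ⟨i, rfl⟩ := Nat.exists_eq_add_of_le' hi
      exact h.ratio_le hX h0 hO hik hC hCA hD hDB h₁ h₂ hor
  · rintro ⟨⟨hA, hB⟩, h1, h2⟩
    -- An axis of `A 0` must be positive at one endpoint at least, so that its interpolated
    -- coordinate is positive in between.
    refine Orthant.isSupport_of_ratio hX hx₁ hx₂ hk (hB₀.trans hA₀.symm) (fun e he => ?_) hO hne
      hAA hBB hAB hA hB h1 h2
    rw [hA₀] at he
    simp only [Orthant.commonAxes, Finset.mem_union, Finset.mem_inter, Finset.mem_filter,
      Orthant.mem_posAxes] at he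
    rcases he with (he | he) | he
    · exact Or.inl he.1
    · exact Or.inl he.1
    · exact Or.inr he.1
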